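/- **Setting.** Let $n\ge 2$, let $M$ be an oriented $(n+1)$-dimensional smooth manifold (spacetime), $c>0$ the speed of light, $q\in\mathbb R$ the specific charge. On a region $\mathcal N\subset M$ we are given a one-form $A$, a two-form $F$ (in the applications $F=\mathrm dA$), a vector field $w$, $(n+1)$-forms $\varrho,\varsigma$, a symmetric $2$-covariant tensor $\mathsf c$ (the relativistic Cauchy deformation tensor) and a Lorentzian metric $\mathsf g$ of signature $(-,+,\dots,+)$, with $\mathsf g(w,w)<0$ and $\mathbf i_w\mathsf c=0$. Put $$u=\frac{c\,w}{\sqrt{-\mathsf g(w,w)}},\quad \rho=\frac{\sqrt{-\mathsf g(w,w)}\,\varrho}{c\,\mu(\mathsf g)},\quad s=\frac{\sqrt{-\mathsf g(w,w)}\,\varsigma}{c\,\mu(\mathsf g)},\quad E=-\tfrac1c\mathbf i_uF,\quad B=-\tfrac1c\mathbf i_u\star F,\quad \mathsf P=\delta+\tfrac1{c^2}u\otimes u^\flat ,$$ where $\mu(\mathsf g)$ is the volume form, $\star$ the Hodge star, $(\star\theta)_{b_1\dots b_l}=\frac1{k!}\theta^{a_1\dots a_k}\mu(\mathsf g)_{a_1\dots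 a_kb_1\dots b_l}$, and $B$ is an $(n-2)$-form. Let $\ell(A,F,w,\varrho,\varsigma,\mathsf c,\mathsf g)$ be a Lagrangian density on $M$ (a fibre-preserving map with values in the $(n+1)$-forms). The stress-energy-momentum tensor (density) of the electromagnetic continuum is the tensor standing under the divergence in the reduced Euler–Lagrange equations on spacetime, $$\mathfrak T=\ell\,\delta+w\otimes\frac{\partial\ell}{\partial w}-\sum_{\kappa\in\{\varrho,\varsigma,\mathsf c\}}\frac{\partial\ell}{\partial\kappa}\therefore\widehat\kappa-\frac{\partial\ell}{\partial A}\otimes A-\frac{\partial\ell}{\partial F}\overset{\rm tr}{\otimes}F ,$$ where $\widehat\kappa$ is defined by $\pounds_\zeta\kappa=\nabla_\zeta\kappa+\widehat\kappa:\nabla\zeta$ (for a torsion-free $\nabla$), $\therefore$ contracts all indices of $\partial\ell/\partial\kappa$ with those of $\kappa$ in $\widehat\kappa$, and for a $k$-vector (density) $\pi$ and a $k$-form $\theta$, $(\pi\overset{\rm tr}{\otimes}\theta)^\mu_\nu=\frac1{(k-1)!}\pi^{\mu\alpha_2\dots\alpha_k}\theta_{\nu\alpha_2\dots\alpha_k}$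 for $k\ge1$ and $0$ for $k=0$. For a symmetric contravariant $\pi$, $(\pi\cdot\mathsf c)^\mu_\nu=\pi^{\lambda\mu}\mathsf c_{\lambda\nu}$; derivatives with respect to $\mathsf c$ are taken in the space of symmetric tensors. $\pi:\theta$ is the full contraction (with $\frac1{k!}$ for forms of degree $k$). **Statement.** At every point of $\mathcal N$ the following hold. **(i)** If $\ell$ is differentiable in $(A,F,w,\varrho,\varsigma,\mathsf c)$ at the given values, then $$\mathfrak T=\Big(\ell-\varrho\frac{\partial\ell}{\partial\varrho}-\varsigma\frac{\partial\ell}{\partial\varsigma}\Big)\delta+w\otimes\frac{\partial\ell}{\partial w}-\frac{\partial\ell}{\partial A}\otimes A-\frac{\partial\ell}{\partial F}\overset{\rm tr}{\otimes}F-\mathfrak t_{\rm el}\,\mu(\mathsf g),\qquad \mathfrak t_{\rm el}\,\mu(\mathsf g)=2\frac{\partial\ell}{\partial\mathsf c}\cdot\mathsf c .$$ **(ii)** Suppose that $\ell=-\epsilon(\rho,s,E,B,\mathsf c,\mathsf g)\,\mu(\mathsf g)-q\rho\,(A\cdot u)\,\mu(\mathsf g)$ for all arguments with $\mathsf g$ Lorentzian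 and $w$ timelike, where $\epsilon$ is spacetime covariant, $\epsilon(\rho\circ\psi,s\circ\psi,\psi^*E,\psi^*B,\psi^*\mathsf c,\psi^*\mathsf g)=\epsilon(\rho,s,E,B,\mathsf c,\mathsf g)\circ\psi$ for all (local) diffeomorphisms $\psi$ of $M$, and is differentiable in $(\rho,s,E,B,\mathsf c)$ at the given values. Then, with the Poynting one-form $S_\epsilon=(-1)^n\frac1c\,\mathbf i_{E^\sharp}\mathbf i_u\star\big(\frac{\partial\epsilon}{\partial B}\big)^\flat$, $$\begin{aligned}\mathfrak T=\Big[&\Big(\epsilon-\frac{\partial\epsilon}{\partial E}\cdot E\Big)\frac1{c^2}u\otimes u^\flat+\frac1c\big(u\otimes S_\epsilon+S_\epsilon^\sharp\otimes u^\flat\big)+\frac{\partial\epsilon}{\partial E}\otimes E-B^\sharp\overset{\rm tr}{\otimes}\Big(\frac{\partial\epsilon}{\partial B}\Big)^\flat\\&+\Big(\frac{\partial\epsilon}{\partial\rho}\rho+\frac{\partial\epsilon}{\partial s}s+\frac{\partial\epsilon}{\partial B}:B-\epsilon\Big)\mathsf P-\mathfrak t_{\rm el}\Big]\mu(\mathsf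 g),\qquad \mathfrak t_{\rm el}=-2\frac{\partial\epsilon}{\partial\mathsf c}\cdot\mathsf c ,\end{aligned}$$ and this $\mathfrak t_{\rm el}$ is the one of (i), that is, $\mathfrak t_{\rm el}\,\mu(\mathsf g)=2\frac{\partial\ell}{\partial\mathsf c}\cdot\mathsf c$. **(iii)** Suppose that $\ell=-\mathfrak e(\rho,s,u,F,\mathsf c,\mathsf g)\,\mu(\mathsf g)-q\rho\,(A\cdot u)\,\mu(\mathsf g)$ for all arguments with $\mathsf g$ Lorentzian and $w$ timelike, with $\mathfrak e$ differentiable in $(\rho,s,u,F,\mathsf c)$ at the given values. Then $$\mathfrak T=\Big[\Big(\mathfrak e-\frac{\partial\mathfrak e}{\partial u}\cdot u\Big)\frac1{c^2}u\otimes u^\flat-u\otimes\frac{\partial\mathfrak e}{\partial u}+\frac{\partial\mathfrak e}{\partial F}\overset{\rm tr}{\otimes}F+\Big(\rho\frac{\partial\mathfrak e}{\partial\rho}+s\frac{\partial\mathfrak e}{\partial s}-\mathfrak e\Big)\mathsf P-\mathfrak t_{\rm el}\Big]\mu(\mathsf g),\qquad \mathfrak t_{\rm el}=-2\frac{\partial\mathfrak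 e}{\partial\mathsf c}\cdot\mathsf c ,$$ and again $\mathfrak t_{\rm el}\,\mu(\mathsf g)=2\frac{\partial\ell}{\partial\mathsf c}\cdot\mathsf c$. -/

import Mathlib

open scoped ContDiff Manifold

set_option maxSynthPendingDepth 3

noncomputable section

namespace EMContinua

/-! ### Tensors on one tangent space

`V` is a tangent space of spacetime, `d` its dimension.  The norm of `V` is auxiliary (`V` is finite
dimensional): it only provides the topology in which Fréchet derivatives are taken. -/

section Algebra

/-- Covectors. -/
abbrev CoV (V : Type*) [NormedAddCommGroup V] [NormedSpace ℝ V] : Type _ := V →L[ℝ] ℝ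

/-- Exterior forms of degree `k`. -/
abbrev Form (V : Type*) [NormedAddCommGroup V] [NormedSpace ℝ V] (k : ℕ) : Type _ :=
  V [⋀^Fin k]→L[ℝ] ℝ

/-- Symmetric covariant 2-tensors, as a subspace of the bilinear forms. -/
def symForms (V : Type*) [NormedAddCommGroup V] [NormedSpace ℝ V] :
    Submodule ℝ (V →L[ℝ] V →L[ℝ] ℝ) where
  carrier := {b | ∀ x y, b x y = b y x}
  add_mem' := by
    intro a b ha hb x y
    simp [ha x y, hb x y]
  zero_mem' := by
    intro x y
    simp
  smul_mem' := by
    intro r a ha x y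
    simp [ha x y]

abbrev SymForm (V : Type*) [NormedAddCommGroup V] [NormedSpace ℝ V] : Type _ := ↥(symForms V)

/-- Orientations of `V`. -/
abbrev Orient (d : ℕ) (V : Type*) [NormedAddCommGroup V] [NormedSpace ℝ V] : Type _ :=
  Orientation ℝ V (Fin d)

/-- A `(1,1)`-tensor `T`, given by its values `T α v = T^μ_ν α_μ v^ν`. -/
abbrev Tensor11 (V : Type*) [NormedAddCommGroup V] [NormedSpace ℝ V] : Type _ := CoV V → V → ℝ

/-- A `(1,1)`-tensor density, given by its values `T α v = T^μ_ν α_μ v^ν` in the top-degree forms. -/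
abbrev Density11 (d : ℕ) (V : Type*) [NormedAddCommGroup V] [NormedSpace ℝ V] : Type _ :=
  CoV V → V → Form V d

variable {V W : Type*} [NormedAddCommGroup V] [NormedSpace ℝ V]
  [NormedAddCommGroup W] [NormedSpace ℝ W]

/-- The evaluation `b(x,y)` of a symmetric tensor. -/
def SymForm.eval (b : SymForm V) (x y : V) : ℝ := (b : V →L[ℝ] V →L[ℝ] ℝ) x y

/-- The covector `b(v, ·)`; for a metric `b` this is `v^♭`. -/
def SymForm.flat (b : SymForm V) (v : V) : CoV V := (b : V →L[ℝ] V →L[ℝ] ℝ) v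

/-- The pull-back `T^* b`. -/
def SymForm.pullback (T : V ≃L[ℝ] W) (b : SymForm W) : SymForm V :=
  ⟨(b : W →L[ℝ] W →L[ℝ] ℝ).bilinearComp (T : V →L[ℝ] W) (T : V →L[ℝ] W), by
    intro x y
    simpa using b.2 (T x) (T y)⟩

/-- The symmetric product `½ (α ⊗ β + β ⊗ α)` of two covectors. -/
def symProd (α β : CoV V) : SymForm V :=
  ⟨(1 / 2 : ℝ) • (α.smulRight β + β.smulRight α), by
    intro x y
    simp
    ring⟩

/-- The interior product `i_v θ`. -/
def interior {k : ℕ} (v : V) (θ : Form V (k + 1)) : Form V k := θ.curryLeft v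

/-- The iterated interior product `θ(v 0, …, v (k-1), ·)`. -/
def contract {l : ℕ} : (k : ℕ) → (Fin k → V) → Form V (l + k) → Form V l
  | 0, _, θ => θ
  | k + 1, v, θ => contract k (fun i => v i.succ) (interior (k := l + k) (v 0) θ)

/-- A 1-form of `V [⋀^Fin 1]→L[ℝ] ℝ` as a covector. -/
def toCoV (θ : Form V 1) : CoV V := (ContinuousAlternatingMap.ofSubsingleton ℝ V ℝ (0 : Fin 1)).symm θ

/-- The exterior product `α ∧ θ` of a covector and a form. -/
def wedge {k : ℕ} (α : CoV V) (θ : Form V k) : Form V (k + 1) :=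
  ContinuousAlternatingMap.alternatizeUncurryFin (α.smulRight θ)

/-- The exterior product `α 0 ∧ … ∧ α (k-1)` of covectors. -/
def wedgeList : (k : ℕ) → (Fin k → CoV V) → Form V k
  | 0, _ => ContinuousAlternatingMap.constOfIsEmpty ℝ V (Fin 0) 1
  | k + 1, α => wedge (α 0) (wedgeList k (fun i => α i.succ))

/-- The tensor `κ̂` of a form `κ`, defined by `£_ζ κ = ∇_ζ κ + κ̂ : ∇ζ`, contracted with `v ⊗ α`:
the form `∑_r κ_{β_1 … β_{r-1} ν β_{r+1} … β_k} v^ν α_{β_r}`, that is `α ∧ i_v κ`. -/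
def hatForm (α : CoV V) (v : V) : {k : ℕ} → Form V k → Form V k
  | 0, _ => 0
  | _ + 1, κ => wedge α (interior v κ)

/-- The tensor `κ̂` of a symmetric 2-tensor `κ`, contracted with `v ⊗ α`:
the tensor `α_{β_1} v^ν κ_{ν β_2} + α_{β_2} v^ν κ_{β_1 ν}`. -/
def hatSym (α : CoV V) (v : V) (κ : SymForm V) : SymForm V :=
  ⟨α.smulRight (κ.flat v) + (κ.flat v).smulRight α, by
    intro x y
    simp
    ring⟩

/-- The frame in which the metric operations below are computed: a positively oriented basis.
None of these operations depends on which one is taken. -/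
def frame {d : ℕ} [NeZero d] [FiniteDimensional ℝ V] [hd : Fact (Module.finrank ℝ V = d)]
    (o : Orient d V) : Module.Basis (Fin d) ℝ V :=
  o.someBasis (by rw [Fintype.card_fin]; exact hd.out.symm)

end Algebra

/-! ### Metric operations -/

section Metric

variable {V : Type*} [NormedAddCommGroup V] [NormedSpace ℝ V] {d : ℕ}

/-- `g` has signature `(-, +, …, +)`. -/
def IsLorentz (d : ℕ) (g : SymForm V) : Prop :=
  ∃ b : Module.Basis (Fin d) ℝ V, ∀ i j,
    g.eval (b i) (b j) = if i = j then (if (i : ℕ) = 0 then -1 else 1) else 0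

/-- The components `g_{ij}` in a basis. -/
def gram (e : Module.Basis (Fin d) ℝ V) (g : SymForm V) : Matrix (Fin d) (Fin d) ℝ :=
  Matrix.of fun i j => g.eval (e i) (e j)

/-- The vector `α^♯ = g^{ij} α_i e_j`. -/
def sharp (e : Module.Basis (Fin d) ℝ V) (g : SymForm V) (α : CoV V) : V :=
  ∑ i, ∑ j, ((gram e g)⁻¹ i j * α (e i)) • e j

/-- The inner product `g(θ,η) = (1/k!) θ_{a_1 … a_k} η^{a_1 … a_k}` of two forms. -/
def formInner (e : Module.Basis (Fin d) ℝ V) (g : SymForm V) {k : ℕ} (θ η : Form V k) : ℝ :=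
  (1 / (k.factorial : ℝ)) * ∑ a : Fin k → Fin d, ∑ b : Fin k → Fin d,
    (∏ i, (gram e g)⁻¹ (a i) (b i)) * θ (fun i => e (a i)) * η (fun i => e (b i))

variable [FiniteDimensional ℝ V]

/-- The dual basis of `e`. -/
def coframe (e : Module.Basis (Fin d) ℝ V) (i : Fin d) : CoV V :=
  LinearMap.toContinuousLinearMap (e.coord i)

/-- The determinant `e^1 ∧ … ∧ e^d` of a basis. -/
def detForm (e : Module.Basis (Fin d) ℝ V) : Form V d :=
  { e.det with
    cont := by
      have h : Continuous fun v : Fin d → V => (e.toMatrix v).det := by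
        refine Continuous.matrix_det (continuous_matrix fun i j => ?_)
        exact (LinearMap.continuous_of_finiteDimensional (e.coord i)).comp (continuous_apply j)
      exact h }

/-- The volume form `μ(g) = |det (g_{ij})|^{1/2} e^1 ∧ … ∧ e^d`, for `e` positively oriented. -/
def vol (e : Module.Basis (Fin d) ℝ V) (g : SymForm V) : Form V d :=
  Real.sqrt |(gram e g).det| • detForm e

/-- A form of degree `d`, read as a form of degree `m = d`. -/
def reindex {m : ℕ} (h : d = m) (θ : Form V d) : Form V m :=
  { θ.toAlternatingMap.domDomCongr (finCongr h) with
    cont := by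
      have : Continuous fun v : Fin m → V => θ (fun i => v (finCongr h i)) :=
        θ.cont.comp (continuous_pi fun i => continuous_apply _)
      exact this }

/-- The Hodge star `(⋆θ)_{b_1 … b_l} = (1/k!) θ^{a_1 … a_k} μ(g)_{a_1 … a_k b_1 … b_l}`. -/
def hodge (e : Module.Basis (Fin d) ℝ V) (g : SymForm V) {k l : ℕ} (h : d = l + k)
    (θ : Form V k) : Form V l :=
  (1 / (k.factorial : ℝ)) • ∑ a : Fin k → Fin d,
    θ (fun i => sharp e g (coframe e (a i))) •
      contract k (fun i => e (a i))
        (reindex h (vol e g))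

/-- The form `Y^♭` of a `k`-vector `Y`, where `Y` is given by its pairing `β ↦ Y : β` with forms:
`Y^♭ = (1/k!) Y^{a_1 … a_k} (e_{a_1})^♭ ∧ … ∧ (e_{a_k})^♭`. -/
def flatMulti (e : Module.Basis (Fin d) ℝ V) (g : SymForm V) {k : ℕ} (Y : Form V k →L[ℝ] ℝ) :
    Form V k :=
  (1 / (k.factorial : ℝ)) • ∑ a : Fin k → Fin d,
    Y (wedgeList k fun i => coframe e (a i)) • wedgeList k (fun i => g.flat (e (a i)))

end Metric

/-! ### The variables and the Lagrangian densities -/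

section Lagrangian

/-- The arguments `(A, F, w, ϱ, ς, 𝖼, g)` of a spacetime Lagrangian density at one point. -/
structure EMState (d : ℕ) (V : Type*) [NormedAddCommGroup V] [NormedSpace ℝ V] where
  /-- electromagnetic potential -/
  A : CoV V
  /-- Faraday 2-form -/
  F : Form V 2
  /-- generalized velocity -/
  w : V
  /-- generalized mass density -/
  mass : Form V d
  /-- generalized entropy density -/
  entropy : Form V d
  /-- relativistic Cauchy deformation tensor -/
  cauchy : SymForm V
  /-- Lorentzian metric -/
  g : SymForm V

/-- Lagrangian densities on one fibre. -/
abbrev Lagrangian (d : ℕ) (V : Type*) [NormedAddCommGroup V] [NormedSpace ℝ V] : Type _ :=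
  EMState d V → Form V d

/-- Energy functions `ε(ρ, s, E, B, 𝖼, g)`, with `B` a `k`-form (`k = n - 2`). -/
abbrev EnergyEB (k : ℕ) (V : Type*) [NormedAddCommGroup V] [NormedSpace ℝ V] : Type _ :=
  ℝ → ℝ → CoV V → Form V k → SymForm V → SymForm V → ℝ

/-- Energy functions `𝔢(ρ, s, u, F, 𝖼, g)`. -/
abbrev EnergyF (V : Type*) [NormedAddCommGroup V] [NormedSpace ℝ V] : Type _ :=
  ℝ → ℝ → V → Form V 2 → SymForm V → SymForm V → ℝ

variable {d k : ℕ} {V : Type*} [NormedAddCommGroup V] [NormedSpace ℝ V]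

/-- The metric is Lorentzian and `w` is timelike. -/
def EMState.Timelike (φ : EMState d V) : Prop := IsLorentz d φ.g ∧ φ.g.eval φ.w φ.w < 0

/-- The world-velocity `u = c w / √(-g(w,w))`. -/
def EMState.u (c : ℝ) (φ : EMState d V) : V := (c / Real.sqrt (-φ.g.eval φ.w φ.w)) • φ.w

/-- The quotient `θ / μ` of two top-degree forms. -/
def ratio (e : Module.Basis (Fin d) ℝ V) (θ μ : Form V d) : ℝ := θ e / μ e

section

variable [FiniteDimensional ℝ V] [NeZero d] [Fact (Module.finrank ℝ V = d)]

/-- The volume form `μ(g)`. -/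
def EMState.μ (o : Orient d V) (φ : EMState d V) : Form V d := vol (frame o) φ.g

/-- The proper mass density `ρ = √(-g(w,w)) ϱ / (c μ(g))`. -/
def EMState.ρ (o : Orient d V) (c : ℝ) (φ : EMState d V) : ℝ :=
  Real.sqrt (-φ.g.eval φ.w φ.w) / c * ratio (frame o) φ.mass (φ.μ o)

/-- The proper entropy density `s = √(-g(w,w)) ς / (c μ(g))`. -/
def EMState.s (o : Orient d V) (c : ℝ) (φ : EMState d V) : ℝ :=
  Real.sqrt (-φ.g.eval φ.w φ.w) / c * ratio (frame o) φ.entropy (φ.μ o)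

/-- The electric field `E = -(1/c) i_u F`. -/
def EMState.E (c : ℝ) (φ : EMState d V) : CoV V := (-(1 / c)) • toCoV (interior (φ.u c) φ.F)

end

section

variable [FiniteDimensional ℝ V] [Fact (Module.finrank ℝ V = k + 3)]

/-- The magnetic field `B = -(1/c) i_u ⋆F`, a form of degree `n - 2`; here `n = k + 2`. -/
def EMState.B (o : Orient (k + 3) V) (c : ℝ) (φ : EMState (k + 3) V) : Form V k :=
  (-(1 / c)) • interior (φ.u c)
    (hodge (l := k + 1) (frame o) φ.g (by omega) φ.F)

/-- `ℓ = -ε(ρ, s, E, B, 𝖼, g) μ(g) - q ρ (A·u) μ(g)`. -/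
def HasFormEB (o : Orient (k + 3) V) (c q : ℝ) (ℓ : Lagrangian (k + 3) V) (ε : EnergyEB k V) :
    Prop :=
  ∀ φ : EMState (k + 3) V, φ.Timelike →
    ℓ φ = (-ε (φ.ρ o c) (φ.s o c) (φ.E c) (φ.B o c) φ.cauchy φ.g) • φ.μ o
      - (q * φ.ρ o c * φ.A (φ.u c)) • φ.μ o

/-- `ℓ = -𝔢(ρ, s, u, F, 𝖼, g) μ(g) - q ρ (A·u) μ(g)`. -/
def HasFormF (o : Orient (k + 3) V) (c q : ℝ) (ℓ : Lagrangian (k + 3) V) (𝔢 : EnergyF V) : Prop :=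
  ∀ φ : EMState (k + 3) V, φ.Timelike →
    ℓ φ = (-𝔢 (φ.ρ o c) (φ.s o c) (φ.u c) φ.F φ.cauchy φ.g) • φ.μ o
      - (q * φ.ρ o c * φ.A (φ.u c)) • φ.μ o

end

end Lagrangian

/-! ### Stress-energy-momentum tensors -/

section Stress

variable {d k : ℕ} {V : Type*} [NormedAddCommGroup V] [NormedSpace ℝ V]

/-! Partial derivatives `∂ℓ/∂A`, …, given by their contraction with a variation. -/

def Lagrangian.dA (ℓ : Lagrangian d V) (φ : EMState d V) : CoV V →L[ℝ] Form V d :=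
  fderiv ℝ (fun A => ℓ { φ with A := A }) φ.A

def Lagrangian.dF (ℓ : Lagrangian d V) (φ : EMState d V) : Form V 2 →L[ℝ] Form V d :=
  fderiv ℝ (fun F => ℓ { φ with F := F }) φ.F

def Lagrangian.dw (ℓ : Lagrangian d V) (φ : EMState d V) : V →L[ℝ] Form V d :=
  fderiv ℝ (fun w => ℓ { φ with w := w }) φ.w

def Lagrangian.dmass (ℓ : Lagrangian d V) (φ : EMState d V) : Form V d →L[ℝ] Form V d :=
  fderiv ℝ (fun r => ℓ { φ with mass := r }) φ.mass

def Lagrangian.dentropy (ℓ : Lagrangian d V) (φ : EMState d V) : Form V d →L[ℝ] Form V d :=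
  fderiv ℝ (fun r => ℓ { φ with entropy := r }) φ.entropy

def Lagrangian.dcauchy (ℓ : Lagrangian d V) (φ : EMState d V) : SymForm V →L[ℝ] Form V d :=
  fderiv ℝ (fun b => ℓ { φ with cauchy := b }) φ.cauchy

/-- `ℓ` is differentiable at `φ` in the variables `(A, F, w, ϱ, ς, 𝖼)`. -/
def Lagrangian.DiffAt (ℓ : Lagrangian d V) (φ : EMState d V) : Prop :=
  DifferentiableAt ℝ
    (fun p : CoV V × Form V 2 × V × Form V d × Form V d × SymForm V =>
      ℓ ⟨p.1, p.2.1, p.2.2.1, p.2.2.2.1, p.2.2.2.2.1, p.2.2.2.2.2, φ.g⟩)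
    (φ.A, φ.F, φ.w, φ.mass, φ.entropy, φ.cauchy)

/-- The stress-energy-momentum tensor density of the continuum, as it stands under the divergence in
the reduced Euler-Lagrange equations on spacetime:
`ℓ δ + w ⊗ ∂ℓ/∂w - ∑_κ ∂ℓ/∂κ ∴ κ̂ - ∂ℓ/∂A ⊗ A - (∂ℓ/∂F) ⊗^{tr} F`,
where `κ` runs over the advected tensors `ϱ`, `ς`, `𝖼`. -/
def stressTensor (ℓ : Lagrangian d V) (φ : EMState d V) : Density11 d V := fun α v =>
  α v • ℓ φ + α φ.w • ℓ.dw φ v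
    - ℓ.dmass φ (hatForm α v φ.mass) - ℓ.dentropy φ (hatForm α v φ.entropy)
    - ℓ.dcauchy φ (hatSym α v φ.cauchy)
    - ℓ.dA φ (φ.A v • α) - ℓ.dF φ (hatForm α v φ.F)

/-- The first fluid expression
`(ℓ - ϱ ∂ℓ/∂ϱ - ς ∂ℓ/∂ς) δ + w ⊗ ∂ℓ/∂w - ∂ℓ/∂A ⊗ A - (∂ℓ/∂F) ⊗^{tr} F`,
with `((∂ℓ/∂F) ⊗^{tr} F)^μ_ν = (∂ℓ/∂F)^{μγ} F_{νγ}`, that is `∂ℓ/∂F : (α ∧ i_v F)` on `(α, v)`. -/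
def fluidStressI (ℓ : Lagrangian d V) (φ : EMState d V) : Density11 d V := fun α v =>
  α v • (ℓ φ - ℓ.dmass φ φ.mass - ℓ.dentropy φ φ.entropy) + α φ.w • ℓ.dw φ v
    - ℓ.dA φ (φ.A v • α) - ℓ.dF φ (wedge α (interior v φ.F))

/-- The contraction `(π · 𝖼)^μ_ν = π^{λμ} 𝖼_{λν}` of a symmetric contravariant 2-tensor `π`, given by
its full contraction `b ↦ π^{λμ} b_{λμ}` with symmetric tensors, with the symmetric tensor `𝖼`. -/
def dotSym {Z : Type*} [NormedAddCommGroup Z] [NormedSpace ℝ Z] (π : SymForm V →L[ℝ] Z)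
    (b : SymForm V) : CoV V → V → Z :=
  fun α v => π (symProd α (b.flat v))

/-- The elastic term `𝔱_el μ(g) = 2 ∂ℓ/∂𝖼 · 𝖼`. -/
def elasticI (ℓ : Lagrangian d V) (φ : EMState d V) : Density11 d V :=
  (2 : ℝ) • dotSym (ℓ.dcauchy φ) φ.cauchy

/-- The projection tensor `P = δ + c⁻² u ⊗ u^♭`. -/
def EMState.P (c : ℝ) (φ : EMState d V) : Tensor11 V :=
  fun α v => α v + 1 / c ^ 2 * (α (φ.u c) * φ.g.eval (φ.u c) v)

/-- The density `T μ` of a `(1,1)`-tensor `T`. -/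
def Tensor11.density (T : Tensor11 V) (μ : Form V d) : Density11 d V := fun α v => T α v • μ

variable [FiniteDimensional ℝ V] [Fact (Module.finrank ℝ V = k + 3)]

/-! Partial derivatives of `ε(ρ, s, E, B, 𝖼, g)`, evaluated at the proper quantities of `φ`. -/

def EnergyEB.val (o : Orient (k + 3) V) (c : ℝ) (ε : EnergyEB k V) (φ : EMState (k + 3) V) : ℝ :=
  ε (φ.ρ o c) (φ.s o c) (φ.E c) (φ.B o c) φ.cauchy φ.g

def EnergyEB.dρ (o : Orient (k + 3) V) (c : ℝ) (ε : EnergyEB k V) (φ : EMState (k + 3) V) : ℝ :=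
  deriv (fun r => ε r (φ.s o c) (φ.E c) (φ.B o c) φ.cauchy φ.g) (φ.ρ o c)

def EnergyEB.ds (o : Orient (k + 3) V) (c : ℝ) (ε : EnergyEB k V) (φ : EMState (k + 3) V) : ℝ :=
  deriv (fun r => ε (φ.ρ o c) r (φ.E c) (φ.B o c) φ.cauchy φ.g) (φ.s o c)

def EnergyEB.dE (o : Orient (k + 3) V) (c : ℝ) (ε : EnergyEB k V) (φ : EMState (k + 3) V) :
    CoV V →L[ℝ] ℝ :=
  fderiv ℝ (fun E => ε (φ.ρ o c) (φ.s o c) E (φ.B o c) φ.cauchy φ.g) (φ.E c)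

def EnergyEB.dB (o : Orient (k + 3) V) (c : ℝ) (ε : EnergyEB k V) (φ : EMState (k + 3) V) :
    Form V k →L[ℝ] ℝ :=
  fderiv ℝ (fun B => ε (φ.ρ o c) (φ.s o c) (φ.E c) B φ.cauchy φ.g) (φ.B o c)

def EnergyEB.dcauchy (o : Orient (k + 3) V) (c : ℝ) (ε : EnergyEB k V) (φ : EMState (k + 3) V) :
    SymForm V →L[ℝ] ℝ :=
  fderiv ℝ (fun b => ε (φ.ρ o c) (φ.s o c) (φ.E c) (φ.B o c) b φ.g) φ.cauchy

/-- `ε` is differentiable in `(ρ, s, E, B, 𝖼)` at the proper quantities of `φ`. -/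
def EnergyEB.DiffAt (o : Orient (k + 3) V) (c : ℝ) (ε : EnergyEB k V) (φ : EMState (k + 3) V) :
    Prop :=
  DifferentiableAt ℝ
    (fun p : ℝ × ℝ × CoV V × Form V k × SymForm V =>
      ε p.1 p.2.1 p.2.2.1 p.2.2.2.1 p.2.2.2.2 φ.g)
    (φ.ρ o c, φ.s o c, φ.E c, φ.B o c, φ.cauchy)

/-- The Poynting one-form `S_ε = (-1)^n (1/c) i_{E^♯} i_u ⋆(∂ε/∂B)^♭`, with `n = k + 2`. -/
def poynting (o : Orient (k + 3) V) (c : ℝ) (ε : EnergyEB k V) (φ : EMState (k + 3) V) : CoV V :=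
  ((-1) ^ (k + 2) * (1 / c)) •
    toCoV (interior (sharp (frame o) φ.g (φ.E c))
      (interior (φ.u c)
        (hodge (l := 3) (frame o) φ.g (by omega) (flatMulti (frame o) φ.g (ε.dB o c φ)))))

/-- The second fluid expression (without the factor `μ(g)`)
`(ε - ∂ε/∂E·E) c⁻² u ⊗ u^♭ + c⁻¹ (u ⊗ S_ε + S_ε^♯ ⊗ u^♭) + ∂ε/∂E ⊗ E
  - B^♯ ⊗^{tr} (∂ε/∂B)^♭ + (∂ε/∂ρ ρ + ∂ε/∂s s + ∂ε/∂B:B - ε) P`,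
with `(B^♯ ⊗^{tr} H)^μ_ν = (1/(n-3)!) B^{μ α_1 …} H_{ν α_1 …}` (and `0` for `n = 2`), that is
`g(B, α ∧ i_v H)` on `(α, v)`. -/
def fluidStressII (o : Orient (k + 3) V) (c : ℝ) (ε : EnergyEB k V) (φ : EMState (k + 3) V) :
    Tensor11 V := fun α v =>
  (ε.val o c φ - ε.dE o c φ (φ.E c)) * (1 / c ^ 2) * (α (φ.u c) * φ.g.eval (φ.u c) v)
    + (1 / c) * (α (φ.u c) * poynting o c ε φ v
        + α (sharp (frame o) φ.g (poynting o c ε φ)) * φ.g.eval (φ.u c) v)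
    + ε.dE o c φ α * φ.E c v
    - formInner (frame o) φ.g (φ.B o c)
        (hatForm α v (flatMulti (frame o) φ.g (ε.dB o c φ)))
    + (ε.dρ o c φ * φ.ρ o c + ε.ds o c φ * φ.s o c + ε.dB o c φ (φ.B o c) - ε.val o c φ)
        * φ.P c α v

/-- The elastic stress `𝔱_el = -2 ∂ε/∂𝖼 · 𝖼`. -/
def elasticII (o : Orient (k + 3) V) (c : ℝ) (ε : EnergyEB k V) (φ : EMState (k + 3) V) :
    Tensor11 V :=
  (-2 : ℝ) • dotSym (ε.dcauchy o c φ) φ.cauchy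

/-! Partial derivatives of `𝔢(ρ, s, u, F, 𝖼, g)`, evaluated at the proper quantities of `φ`. -/

def EnergyF.val (o : Orient (k + 3) V) (c : ℝ) (𝔢 : EnergyF V) (φ : EMState (k + 3) V) : ℝ :=
  𝔢 (φ.ρ o c) (φ.s o c) (φ.u c) φ.F φ.cauchy φ.g

def EnergyF.dρ (o : Orient (k + 3) V) (c : ℝ) (𝔢 : EnergyF V) (φ : EMState (k + 3) V) : ℝ :=
  deriv (fun r => 𝔢 r (φ.s o c) (φ.u c) φ.F φ.cauchy φ.g) (φ.ρ o c)

def EnergyF.ds (o : Orient (k + 3) V) (c : ℝ) (𝔢 : EnergyF V) (φ : EMState (k + 3) V) : ℝ :=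
  deriv (fun r => 𝔢 (φ.ρ o c) r (φ.u c) φ.F φ.cauchy φ.g) (φ.s o c)

def EnergyF.du (o : Orient (k + 3) V) (c : ℝ) (𝔢 : EnergyF V) (φ : EMState (k + 3) V) : V →L[ℝ] ℝ :=
  fderiv ℝ (fun u => 𝔢 (φ.ρ o c) (φ.s o c) u φ.F φ.cauchy φ.g) (φ.u c)

def EnergyF.dF (o : Orient (k + 3) V) (c : ℝ) (𝔢 : EnergyF V) (φ : EMState (k + 3) V) :
    Form V 2 →L[ℝ] ℝ :=
  fderiv ℝ (fun F => 𝔢 (φ.ρ o c) (φ.s o c) (φ.u c) F φ.cauchy φ.g) φ.F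

def EnergyF.dcauchy (o : Orient (k + 3) V) (c : ℝ) (𝔢 : EnergyF V) (φ : EMState (k + 3) V) :
    SymForm V →L[ℝ] ℝ :=
  fderiv ℝ (fun b => 𝔢 (φ.ρ o c) (φ.s o c) (φ.u c) φ.F b φ.g) φ.cauchy

/-- `𝔢` is differentiable in `(ρ, s, u, F, 𝖼)` at the proper quantities of `φ`. -/
def EnergyF.DiffAt (o : Orient (k + 3) V) (c : ℝ) (𝔢 : EnergyF V) (φ : EMState (k + 3) V) : Prop :=
  DifferentiableAt ℝ
    (fun p : ℝ × ℝ × V × Form V 2 × SymForm V => 𝔢 p.1 p.2.1 p.2.2.1 p.2.2.2.1 p.2.2.2.2 φ.g)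
    (φ.ρ o c, φ.s o c, φ.u c, φ.F, φ.cauchy)

/-- The third fluid expression (without the factor `μ(g)`)
`(𝔢 - ∂𝔢/∂u·u) c⁻² u ⊗ u^♭ - u ⊗ ∂𝔢/∂u + (∂𝔢/∂F) ⊗^{tr} F + (ρ ∂𝔢/∂ρ + s ∂𝔢/∂s - 𝔢) P`. -/
def fluidStressIII (o : Orient (k + 3) V) (c : ℝ) (𝔢 : EnergyF V) (φ : EMState (k + 3) V) :
    Tensor11 V := fun α v =>
  (𝔢.val o c φ - 𝔢.du o c φ (φ.u c)) * (1 / c ^ 2) * (α (φ.u c) * φ.g.eval (φ.u c) v)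
    - α (φ.u c) * 𝔢.du o c φ v
    + 𝔢.dF o c φ (wedge α (interior v φ.F))
    + (φ.ρ o c * 𝔢.dρ o c φ + φ.s o c * 𝔢.ds o c φ - 𝔢.val o c φ) * φ.P c α v

/-- The elastic stress `𝔱_el = -2 ∂𝔢/∂𝖼 · 𝖼`. -/
def elasticIII (o : Orient (k + 3) V) (c : ℝ) (𝔢 : EnergyF V) (φ : EMState (k + 3) V) :
    Tensor11 V :=
  (-2 : ℝ) • dotSym (𝔢.dcauchy o c φ) φ.cauchy

end Stress

/-! ### Spacetime -/

section Spacetime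

variable {d : ℕ} {M : Type*} [TopologicalSpace M] [ChartedSpace (EuclideanSpace ℝ (Fin d)) M]

instance tangentNormedAddCommGroup (x : M) : NormedAddCommGroup (TangentSpace (𝓡 d) x) :=
  inferInstanceAs (NormedAddCommGroup (EuclideanSpace ℝ (Fin d)))

instance tangentNormedSpace (x : M) : NormedSpace ℝ (TangentSpace (𝓡 d) x) :=
  inferInstanceAs (NormedSpace ℝ (EuclideanSpace ℝ (Fin d)))

instance tangentFiniteDimensional (x : M) : FiniteDimensional ℝ (TangentSpace (𝓡 d) x) :=
  inferInstanceAs (FiniteDimensional ℝ (EuclideanSpace ℝ (Fin d)))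

instance tangentFinrank (x : M) : Fact (Module.finrank ℝ (TangentSpace (𝓡 d) x) = d) :=
  ⟨finrank_euclideanSpace_fin (𝕜 := ℝ) (n := d)⟩

/-- Spacetime covariance of the energy function:
`ε(ρ∘ψ, s∘ψ, ψ^*E, ψ^*B, ψ^*𝖼, ψ^*g) = ε(ρ, s, E, B, 𝖼, g) ∘ ψ` for the (local) diffeomorphisms `ψ`
of `M`.  The differentials at `x` of the local diffeomorphisms with `ψ(x) = y` are exactly the linear
isomorphisms `T_x M → T_y M`. -/
def SpacetimeCovariant {k : ℕ} (ε : ∀ x : M, EnergyEB k (TangentSpace (𝓡 d) x)) : Prop :=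
  ∀ (x y : M) (T : TangentSpace (𝓡 d) x ≃L[ℝ] TangentSpace (𝓡 d) y) (ρ s : ℝ)
    (E : CoV (TangentSpace (𝓡 d) y)) (B : Form (TangentSpace (𝓡 d) y) k)
    (b g : SymForm (TangentSpace (𝓡 d) y)), IsLorentz d g →
    ε x ρ s (E.comp (T : TangentSpace (𝓡 d) x →L[ℝ] TangentSpace (𝓡 d) y))
        (B.compContinuousLinearMap (T : TangentSpace (𝓡 d) x →L[ℝ] TangentSpace (𝓡 d) y))
        (b.pullback T) (g.pullback T)
      = ε y ρ s E B b g

end Spacetime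

end EMContinua

end

/-!
Everything happens on one tangent space `V` of dimension `k + 3`, where the three formulas are statements
about partial derivatives.

The first formula is multilinear algebra: `α ∧ i_v` multiplies a top-degree form by `α(v)`
(`hatForm_top`), and `κ̂` of a symmetric tensor is twice a symmetric product (`hatSym_eq`).

The third formula is the chain rule (`HasFormF.fderiv_apply`).  The only nonlinear dependence is the one
of `ρ`, `s` and `u` on `w` through `√(-g(w,w))`; the coupling `q ρ (A·u)` depends on `w` through
`ρ u = (ϱ/μ) w` only, and its contribution to `w ⊗ ∂ℓ/∂w` cancels the one of `∂ℓ/∂A ⊗ A`.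

The second formula follows from the third, applied to `𝔢 = ε(ρ, s, -c⁻¹ i_u F, -c⁻¹ i_u ⋆F, 𝖼, g)`.  The
terms with `∂ε/∂E` agree at once.  For those with `Y = ∂ε/∂B`, covariance enters through the reflection in
`u^⊥`: it fixes `E`, `B`, `𝖼` and `g`, hence `Y` annihilates the forms `u^♭ ∧ i_u θ`
(`dB_hatForm_eq_zero`) and sees only the values of a form on vectors orthogonal to `u`
(`apply_eq_zero_of_spatial`).  The Poynting form and the pairing with `(∂ε/∂B)^♭` are both values of `Y`
(`IsLorentz.hodge_flatMulti`, `IsLorentz.formInner_hatForm_flatMulti`), so that an identity between forms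
remains, to be checked on vectors orthogonal to `u`.  It is linear in `F`; for `F = a^♭ ∧ b^♭`, where
`⋆F = μ(a, b, ·)`, it combines three instances of `λ ∧ i_p μ = λ(p) μ`
(`IsLorentz.magnetic_identity_apply`).
-/

noncomputable section

namespace EMContinua

/-! ### Exterior algebra: the derivation `θ ↦ α ∧ i_v θ` -/

section Derivation

variable {V : Type*} [NormedAddCommGroup V] [NormedSpace ℝ V]

@[simp]
theorem interior_apply {k : ℕ} (v : V) (θ : Form V (k + 1)) (z : Fin k → V) :
    interior v θ z = θ (Matrix.vecCons v z) := rfl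

@[simp]
theorem toCoV_apply (θ : Form V 1) (v : V) : toCoV θ v = θ ![v] := by
  have h : (fun _ : Fin 1 => v) = ![v] := by
    funext i
    fin_cases i
    rfl
  rw [← h]
  rfl

theorem wedge_apply {k : ℕ} (α : CoV V) (θ : Form V k) (z : Fin (k + 1) → V) :
    wedge α θ z = ∑ i : Fin (k + 1), (-1) ^ (i : ℕ) * (α (z i) * θ (fun j => z (i.succAbove j))) := by
  unfold wedge
  rw [ContinuousAlternatingMap.alternatizeUncurryFin_apply]
  refine Finset.sum_congr rfl fun i _ => ?_
  rw [zsmul_eq_mul]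
  push_cast
  rfl

@[simp]
theorem wedge_zero {k : ℕ} (α : CoV V) : wedge α (0 : Form V k) = 0 := by
  ext z
  simp [wedge_apply]

/-- The interior product is an antiderivation. -/
theorem wedge_vecCons {k : ℕ} (α : CoV V) (θ : Form V (k + 1)) (v : V) (z : Fin (k + 1) → V) :
    wedge α θ (Matrix.vecCons v z) = α v * θ z - wedge α (interior v θ) z := by
  rw [wedge_apply, Fin.sum_univ_succ, wedge_apply, sub_eq_add_neg, ← Finset.sum_neg_distrib]
  congr 1
  · simp
  · refine Finset.sum_congr rfl fun i _ => ?_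
    have h : (fun j => (Matrix.vecCons v z : Fin (k + 2) → V) (i.succ.succAbove j))
        = Matrix.vecCons v fun j => z (i.succAbove j) := by
      funext j
      cases j using Fin.cases <;> simp
    rw [h, interior_apply]
    simp [pow_succ]

theorem wedge_vecCons_zero (α : CoV V) (θ : Form V 0) (v : V) (z : Fin 0 → V) :
    wedge α θ (Matrix.vecCons v z) = α v * θ z := by
  rw [wedge_apply]
  simp
  left
  congr 1
  exact Subsingleton.elim _ _

theorem interior_swap {k : ℕ} (u v : V) (θ : Form V (k + 2)) :
    interior u (interior v θ) = -interior v (interior u θ) := by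
  ext z
  have h := θ.toAlternatingMap.map_swap (Matrix.vecCons v (Matrix.vecCons u z))
    (i := 0) (j := 1) (by simp)
  have h2 : (Matrix.vecCons v (Matrix.vecCons u z)) ∘ (Equiv.swap (0 : Fin (k + 2)) 1)
      = Matrix.vecCons u (Matrix.vecCons v z) := by
    funext i
    refine Fin.cases ?_ (fun i => Fin.cases ?_ (fun i => ?_) i) i
    · simp
    · simp
    · have : Equiv.swap (0 : Fin (k + 2)) 1 i.succ.succ = i.succ.succ :=
        Equiv.swap_apply_of_ne_of_ne (Fin.succ_ne_zero _) (by simp [Fin.ext_iff])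
      simp [this]
  rw [h2] at h
  simp only [ContinuousAlternatingMap.neg_apply, interior_apply]
  change θ _ = - θ _ at h
  rw [h, neg_neg]

theorem vecCons_swap {k : ℕ} (θ : Form V (k + 2)) (u v : V) (z : Fin k → V) :
    θ (Matrix.vecCons u (Matrix.vecCons v z)) = -θ (Matrix.vecCons v (Matrix.vecCons u z)) :=
  congrArg (fun η : Form V k => η z) (interior_swap v u θ)

/-- The derivation `θ ↦ α ∧ i_v θ` acts slot by slot. -/
theorem hatForm_vecCons {k : ℕ} (α : CoV V) (v : V) (θ : Form V (k + 1)) (w : V) (z : Fin k → V) :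
    hatForm α v θ (Matrix.vecCons w z)
      = α w * θ (Matrix.vecCons v z) + hatForm α v (interior w θ) z := by
  cases k with
  | zero =>
    change wedge α (interior v θ) _ = _ + (0 : Form V 0) z
    rw [wedge_vecCons_zero]
    simp
  | succ k =>
    change wedge α (interior v θ) _ = _ + wedge α (interior v (interior w θ)) z
    rw [wedge_vecCons, interior_swap]
    have : wedge α (-interior v (interior w θ)) z = -wedge α (interior v (interior w θ)) z := by
      simp [wedge_apply]
    rw [this]
    simp

theorem hatForm_add {k : ℕ} (α : CoV V) (v : V) (θ η : Form V k) :
    hatForm α v (θ + η) = hatForm α v θ + hatForm α v η := by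
  induction k with
  | zero => simp [hatForm]
  | succ k ih =>
    ext z
    rw [← Fin.cons_self_tail z]
    change hatForm _ _ _ (Matrix.vecCons _ _) = hatForm _ _ _ (Matrix.vecCons _ _)
      + hatForm _ _ _ (Matrix.vecCons _ _)
    simp only [hatForm_vecCons]
    have : interior (z 0) (θ + η) = interior (z 0) θ + interior (z 0) η := rfl
    rw [this, ih]
    simp
    ring

theorem hatForm_smul {k : ℕ} (α : CoV V) (v : V) (r : ℝ) (θ : Form V k) :
    hatForm α v (r • θ) = r • hatForm α v θ := by
  induction k with
  | zero => simp [hatForm]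
  | succ k ih =>
    ext z
    rw [← Fin.cons_self_tail z]
    change hatForm _ _ _ (Matrix.vecCons _ _) = r * hatForm _ _ _ (Matrix.vecCons _ _)
    simp only [hatForm_vecCons]
    have : interior (z 0) (r • θ) = r • interior (z 0) θ := rfl
    rw [this, ih]
    simp
    ring

theorem hatForm_apply_eq_zero {k : ℕ} (α : CoV V) (v : V) (θ : Form V k) (z : Fin k → V)
    (hz : ∀ i, α (z i) = 0) : hatForm α v θ z = 0 := by
  induction k with
  | zero => rfl
  | succ k ih =>
    rw [← Fin.cons_self_tail z]
    change hatForm _ _ _ (Matrix.vecCons _ _) = 0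
    rw [hatForm_vecCons, hz 0, ih _ (Fin.tail z) fun i => hz i.succ]
    simp

theorem hatForm_interior_self {k : ℕ} (α : CoV V) (v : V) (θ : Form V (k + 1)) :
    hatForm α v (interior v θ) = 0 := by
  cases k with
  | zero => rfl
  | succ k =>
    have : interior v (interior v θ) = 0 := by
      simp [interior]
    simp [hatForm, this]

/-- The pull-back by the rank-one perturbation `id + v ⊗ α` is affine in the perturbation, because a
form vanishes when `v` fills two of its slots. -/
theorem pullback_rankOne {k : ℕ} (α : CoV V) (v : V) (θ : Form V k) (z : Fin k → V) :
    θ (fun i => z i + α (z i) • v) = θ z + hatForm α v θ z := by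
  induction k with
  | zero =>
    change _ = θ z + 0
    rw [add_zero]
    congr 1
    exact Subsingleton.elim _ _
  | succ k ih =>
    obtain ⟨w, z, rfl⟩ : ∃ w y, z = Matrix.vecCons w y := ⟨z 0, Fin.tail z, (Fin.cons_self_tail z).symm⟩
    have h1 : (fun i => (Matrix.vecCons w z : Fin (k + 1) → V) i
        + α ((Matrix.vecCons w z : Fin (k + 1) → V) i) • v)
        = Matrix.vecCons (w + α w • v) fun i => z i + α (z i) • v := by
      funext i
      cases i using Fin.cases <;> simp
    rw [h1, hatForm_vecCons]
    have h3 := θ.toAlternatingMap.map_vecCons_add (fun i => z i + α (z i) • v) w (α w • v)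
    have h4 := θ.toAlternatingMap.map_vecCons_smul (fun i => z i + α (z i) • v) (α w) v
    change θ _ = θ _ + θ _ at h3
    change θ _ = α w • θ _ at h4
    rw [h3, h4, ← interior_apply w, ← interior_apply v, ih, ih, hatForm_interior_self]
    simp
    ring

/-- In top degree the derivation `θ ↦ α ∧ i_v θ` is multiplication by `α(v)`. -/
theorem hatForm_top {d : ℕ} [FiniteDimensional ℝ V] (hd : Module.finrank ℝ V = d + 1) (α : CoV V)
    (v : V) (θ : Form V (d + 1)) : hatForm α v θ = α v • θ := by
  ext z
  have h : wedge α θ (Matrix.vecCons v z) = 0 := by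
    refine (wedge α θ).toAlternatingMap.map_linearDependent _ fun hli => ?_
    have := hli.fintype_card_le_finrank
    simp [hd] at this
  rw [wedge_vecCons] at h
  change wedge α (interior v θ) z = α v * θ z
  linarith

end Derivation

/-! ### Exterior products of covectors -/

section Products

variable {V : Type*} [NormedAddCommGroup V] [NormedSpace ℝ V]

/-- Laplace expansion along the first row. -/
theorem wedgeList_apply {k : ℕ} (α : Fin k → CoV V) (z : Fin k → V) :
    wedgeList k α z = (Matrix.of fun i j => α i (z j)).det := by
  induction k with
  | zero => simp [wedgeList]
  | succ k ih =>
    change wedge (α 0) (wedgeList k fun i => α i.succ) z = _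
    rw [wedge_apply, Matrix.det_succ_row_zero]
    refine Finset.sum_congr rfl fun i _ => ?_
    rw [ih, mul_assoc]
    rfl

/-- The pull-back of a form by a continuous linear map. -/
def Form.comp {k : ℕ} (θ : Form V k) (T : V →L[ℝ] V) : Form V k := θ.compContinuousLinearMap T

@[simp]
theorem Form.comp_apply {k : ℕ} (θ : Form V k) (T : V →L[ℝ] V) (z : Fin k → V) :
    θ.comp T z = θ (fun i => T (z i)) := rfl

theorem Form.comp_rankOne {k : ℕ} (θ : Form V k) (α : CoV V) (v : V) :
    θ.comp (ContinuousLinearMap.id ℝ V + α.smulRight v) = θ + hatForm α v θ := by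
  ext z
  exact pullback_rankOne α v θ z

variable {d : ℕ} [FiniteDimensional ℝ V] (e : Module.Basis (Fin d) ℝ V)

@[simp]
theorem coframe_apply (i : Fin d) (v : V) : coframe e i v = e.repr v i := rfl

theorem sum_coframe_smul (v : V) : ∑ i, coframe e i v • e i = v := e.sum_repr v

/-- The components of an alternating map contracted with the components of `y_1 ∧ … ∧ y_k`. -/
theorem sum_wedgeList_coframe_smul {Z : Type*} [AddCommGroup Z] [Module ℝ Z] {k : ℕ}
    (G : V [⋀^Fin k]→ₗ[ℝ] Z) (y : Fin k → V) :
    ∑ a : Fin k → Fin d, wedgeList k (fun i => coframe e (a i)) y • G (fun i => e (a i))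
      = (k.factorial : ℝ) • G y := by
  have key : ∀ x : Fin k → V,
      ∑ a : Fin k → Fin d, (∏ i, coframe e (a i) (x i)) • G (fun i => e (a i)) = G x := by
    intro x
    conv_rhs => rw [show x = fun i => ∑ j, coframe e j (x i) • e j from
      funext fun i => (sum_coframe_smul e (x i)).symm]
    have h1 := G.toMultilinearMap.map_sum (fun i (j : Fin d) => coframe e j (x i) • e j)
    change G _ = ∑ r : Fin k → Fin d, G (fun i => coframe e (r i) (x i) • e (r i)) at h1
    rw [h1]
    refine Finset.sum_congr rfl fun a _ => ?_
    exact (G.toMultilinearMap.map_smul_univ (fun i => coframe e (a i) (x i)) fun i => e (a i)).symm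
  have h2 : ∀ a : Fin k → Fin d, wedgeList k (fun i => coframe e (a i)) y
      = ∑ σ : Equiv.Perm (Fin k), ((Equiv.Perm.sign σ : ℤ) : ℝ) * ∏ i, coframe e (a i) (y (σ i)) := by
    intro a
    rw [wedgeList_apply, ← Matrix.det_transpose, Matrix.det_apply']
    rfl
  simp_rw [h2, Finset.sum_smul]
  rw [Finset.sum_comm]
  have h3 : ∀ σ : Equiv.Perm (Fin k), ∑ a : Fin k → Fin d,
      (((Equiv.Perm.sign σ : ℤ) : ℝ) * ∏ i, coframe e (a i) (y (σ i))) • G (fun i => e (a i)) = G y := by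
    intro σ
    simp_rw [mul_smul]
    rw [← Finset.smul_sum, key fun i => y (σ i)]
    have h4 := G.map_perm y σ
    change G (fun i => y (σ i)) = _ at h4
    rw [h4]
    rcases Int.units_eq_one_or (Equiv.Perm.sign σ) with h | h <;> simp [h]
  simp_rw [h3]
  simp [Fintype.card_perm, Nat.cast_smul_eq_nsmul]

/-- Scalar form of `sum_wedgeList_coframe_smul`, normalized. -/
theorem sum_wedgeList_coframe_mul {k : ℕ} (G : Form V k) (y : Fin k → V) :
    (1 / (k.factorial : ℝ)) * ∑ a : Fin k → Fin d,
      wedgeList k (fun i => coframe e (a i)) y * G (fun i => e (a i)) = G y := by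
  have h := sum_wedgeList_coframe_smul e G.toAlternatingMap y
  change ∑ a : Fin k → Fin d, _ * G _ = (k.factorial : ℝ) * G y at h
  have hk : (k.factorial : ℝ) ≠ 0 := by positivity
  rw [h]
  field_simp

/-- A form is the combination of the products of coframe covectors given by its components. -/
theorem form_eq_sum_wedgeList {k : ℕ} (θ : Form V k) :
    θ = (1 / (k.factorial : ℝ)) • ∑ a : Fin k → Fin d,
      θ (fun i => e (a i)) • wedgeList k (fun i => coframe e (a i)) := by
  ext y
  rw [← sum_wedgeList_coframe_mul e θ y]
  simp [ContinuousAlternatingMap.sum_apply, mul_comm]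

theorem apply_eq_sum_wedgeList {k : ℕ} (Y : Form V k →L[ℝ] ℝ) (θ : Form V k) :
    (1 / (k.factorial : ℝ)) * ∑ a : Fin k → Fin d,
      Y (wedgeList k (fun i => coframe e (a i))) * θ (fun i => e (a i)) = Y θ := by
  conv_rhs => rw [form_eq_sum_wedgeList e θ]
  simp [map_sum, mul_comm]

end Products

/-! ### Raising and lowering indices -/

section Metric

variable {V : Type*} [NormedAddCommGroup V] [NormedSpace ℝ V] {d : ℕ} {g : SymForm V}

theorem SymForm.eval_comm (g : SymForm V) (x y : V) : g.eval x y = g.eval y x := g.2 x y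

@[simp]
theorem SymForm.flat_apply (g : SymForm V) (x y : V) : g.flat x y = g.eval x y := rfl

theorem SymForm.eval_add_left (g : SymForm V) (x y z : V) :
    g.eval (x + y) z = g.eval x z + g.eval y z := by simp [SymForm.eval]

theorem SymForm.eval_smul_left (g : SymForm V) (r : ℝ) (x z : V) :
    g.eval (r • x) z = r * g.eval x z := by simp [SymForm.eval]

theorem SymForm.eval_add_right (g : SymForm V) (x y z : V) :
    g.eval x (y + z) = g.eval x y + g.eval x z := by simp [SymForm.eval]

theorem SymForm.eval_smul_right (g : SymForm V) (r : ℝ) (x z : V) :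
    g.eval x (r • z) = r * g.eval x z := by simp [SymForm.eval]

/-- A Lorentzian metric is nondegenerate. -/
theorem IsLorentz.eq_zero (hg : IsLorentz d g) {v : V} (hv : g.flat v = 0) : v = 0 := by
  obtain ⟨b, hb⟩ := hg
  refine b.ext_elem_iff.2 fun i => ?_
  have h : g.eval v (b i) = 0 := by
    rw [← SymForm.flat_apply, hv]
    rfl
  have h1 : g.eval v (b i) = ∑ j, b.repr v j * g.eval (b j) (b i) := by
    conv_lhs => rw [← b.sum_repr v]
    simp only [SymForm.eval, map_sum, map_smul, sum_apply, smul_apply, smul_eq_mul]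
  rw [h1] at h
  simp only [hb, mul_ite, mul_zero, Finset.sum_ite_eq', Finset.mem_univ, if_true] at h
  split_ifs at h <;> simpa using h

theorem IsLorentz.det_gram_ne_zero (hg : IsLorentz d g) (e : Module.Basis (Fin d) ℝ V) :
    IsUnit (gram e g).det := by
  rw [isUnit_iff_ne_zero]
  intro h
  obtain ⟨x, hx, hx0⟩ := Matrix.exists_vecMul_eq_zero_iff.2 h
  apply hx
  have h1 : g.flat (∑ i, x i • e i) = 0 := by
    refine ContinuousLinearMap.coe_injective (e.ext fun j => ?_)
    have := congrFun hx0 j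
    simpa [Matrix.vecMul, dotProduct, gram, SymForm.eval] using this
  have h2 := hg.eq_zero h1
  funext i
  exact (Fintype.linearIndependent_iff.1 e.linearIndependent) x h2 i

theorem IsLorentz.flat_sharp (hg : IsLorentz d g) (e : Module.Basis (Fin d) ℝ V) (α : CoV V) :
    g.flat (sharp e g α) = α := by
  refine ContinuousLinearMap.coe_injective (e.ext fun m => ?_)
  change g.eval _ _ = α (e m)
  have h : g.eval (sharp e g α) (e m)
      = ∑ i, (∑ j, (gram e g)⁻¹ i j * gram e g j m) * α (e i) := by
    simp only [sharp, SymForm.eval, gram, map_sum, map_smul, sum_apply,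
      smul_apply, smul_eq_mul, Finset.sum_mul, Matrix.of_apply]
    refine Finset.sum_congr rfl fun i _ => Finset.sum_congr rfl fun j _ => ?_
    ring
  rw [h]
  have h2 : ∀ i, ∑ j, (gram e g)⁻¹ i j * gram e g j m = (1 : Matrix (Fin d) (Fin d) ℝ) i m := by
    intro i
    rw [← Matrix.nonsing_inv_mul _ (hg.det_gram_ne_zero e), Matrix.mul_apply]
  simp [h2, Matrix.one_apply]

theorem IsLorentz.sharp_flat (hg : IsLorentz d g) (e : Module.Basis (Fin d) ℝ V) (v : V) :
    sharp e g (g.flat v) = v := by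
  have h := hg.flat_sharp e (g.flat v)
  have h2 : g.flat (sharp e g (g.flat v) - v) = 0 := by
    change (g : V →L[ℝ] V →L[ℝ] ℝ) (_ - _) = 0
    rw [map_sub, sub_eq_zero]
    exact h
  exact sub_eq_zero.1 (hg.eq_zero h2)

theorem IsLorentz.eval_sharp (hg : IsLorentz d g) (e : Module.Basis (Fin d) ℝ V) (α : CoV V)
    (v : V) : g.eval (sharp e g α) v = α v := by
  rw [← SymForm.flat_apply, hg.flat_sharp]

theorem IsLorentz.apply_sharp_comm (hg : IsLorentz d g) (e : Module.Basis (Fin d) ℝ V)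
    (α β : CoV V) : α (sharp e g β) = β (sharp e g α) := by
  rw [← hg.eval_sharp e α, ← hg.eval_sharp e β, g.eval_comm]

variable [FiniteDimensional ℝ V]

/-- The form `Y^♭` on the vectors `z` is the value of `Y` on the product of the covectors `z^♭`. -/
theorem flatMulti_apply (e : Module.Basis (Fin d) ℝ V) (g : SymForm V) {k : ℕ}
    (Y : Form V k →L[ℝ] ℝ) (z : Fin k → V) :
    flatMulti e g Y z = Y (wedgeList k fun i => g.flat (z i)) := by
  rw [← apply_eq_sum_wedgeList e Y]
  simp only [flatMulti, ContinuousAlternatingMap.smul_apply, ContinuousAlternatingMap.sum_apply,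
    smul_eq_mul]
  congr 1
  refine Finset.sum_congr rfl fun a _ => ?_
  congr 1
  rw [wedgeList_apply, wedgeList_apply, ← Matrix.det_transpose]
  congr 1
  ext i j
  exact g.eval_comm _ _

theorem IsLorentz.flatMulti_sharp (hg : IsLorentz d g) (e : Module.Basis (Fin d) ℝ V) {k : ℕ}
    (Y : Form V k →L[ℝ] ℝ) (α : Fin k → CoV V) :
    flatMulti e g Y (fun i => sharp e g (α i)) = Y (wedgeList k α) := by
  rw [flatMulti_apply]
  simp only [hg.flat_sharp]

theorem formInner_eq_sum (e : Module.Basis (Fin d) ℝ V) (g : SymForm V) {k : ℕ} (θ η : Form V k) :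
    formInner e g θ η = (1 / (k.factorial : ℝ)) * ∑ a : Fin k → Fin d,
      θ (fun i => e (a i)) * η (fun i => sharp e g (coframe e (a i))) := by
  unfold formInner
  congr 1
  refine Finset.sum_congr rfl fun a _ => ?_
  have h : ∀ i, sharp e g (coframe e (a i)) = ∑ j, (gram e g)⁻¹ (a i) j • e j := by
    intro i
    unfold sharp
    rw [Finset.sum_eq_single (a i)]
    · simp
    · intro b _ hb
      refine Finset.sum_eq_zero fun j _ => ?_
      simp [hb]
    · simp
  simp_rw [h]
  have h1 := η.toMultilinearMap.map_sum (fun i (j : Fin d) => (gram e g)⁻¹ (a i) j • e j)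
  change η _ = ∑ r : Fin k → Fin d, η (fun i => (gram e g)⁻¹ (a i) (r i) • e (r i)) at h1
  rw [h1, Finset.mul_sum]
  refine Finset.sum_congr rfl fun b _ => ?_
  have h2 := η.toMultilinearMap.map_smul_univ (fun i => (gram e g)⁻¹ (a i) (b i)) fun i => e (b i)
  change η _ = _ * η _ at h2
  rw [h2]
  ring

/-- The pull-backs by `id + v ⊗ α` and by its metric adjoint `id + α^♯ ⊗ v^♭` are adjoint to each
other. -/
theorem IsLorentz.formInner_flatMulti_comp (hg : IsLorentz d g) (e : Module.Basis (Fin d) ℝ V)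
    {k : ℕ} (Y : Form V k →L[ℝ] ℝ) (θ : Form V k) (α : CoV V) (v : V) :
    formInner e g θ ((flatMulti e g Y).comp (ContinuousLinearMap.id ℝ V + α.smulRight v))
      = Y (θ.comp (ContinuousLinearMap.id ℝ V + (g.flat v).smulRight (sharp e g α))) := by
  rw [formInner_eq_sum, form_eq_sum_wedgeList e θ]
  have h1 : ∀ a : Fin k → Fin d,
      (flatMulti e g Y).comp (ContinuousLinearMap.id ℝ V + α.smulRight v)
        (fun i => sharp e g (coframe e (a i)))
      = Y ((wedgeList k fun i => coframe e (a i)).comp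
          (ContinuousLinearMap.id ℝ V + (g.flat v).smulRight (sharp e g α))) := by
    intro a
    rw [Form.comp_apply, flatMulti_apply]
    congr 1
    ext z
    rw [Form.comp_apply, wedgeList_apply, wedgeList_apply]
    congr 1
    ext i j
    have := hg.apply_sharp_comm e α (coframe e (a i))
    have h2 := hg.eval_sharp e (coframe e (a i)) (z j)
    simp only [Matrix.of_apply, add_apply, ContinuousLinearMap.id_apply,
      ContinuousLinearMap.smulRight_apply, SymForm.flat_apply, SymForm.eval_add_left,
      SymForm.eval_smul_left, map_add, map_smul, smul_eq_mul, this, h2]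
    ring
  simp only [h1]
  rw [← form_eq_sum_wedgeList e θ]
  conv_rhs => rw [form_eq_sum_wedgeList e θ]
  have h3 : ∀ T : V →L[ℝ] V, ((1 / (k.factorial : ℝ)) • ∑ a : Fin k → Fin d,
      θ (fun i => e (a i)) • wedgeList k (fun i => coframe e (a i))).comp T
      = (1 / (k.factorial : ℝ)) • ∑ a : Fin k → Fin d,
      θ (fun i => e (a i)) • (wedgeList k (fun i => coframe e (a i))).comp T := by
    intro T
    ext z
    simp [ContinuousAlternatingMap.sum_apply]
  rw [h3]
  simp [map_sum]

theorem IsLorentz.formInner_flatMulti (hg : IsLorentz d g) (e : Module.Basis (Fin d) ℝ V) {k : ℕ}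
    (Y : Form V k →L[ℝ] ℝ) (θ : Form V k) : formInner e g θ (flatMulti e g Y) = Y θ := by
  rw [formInner_eq_sum]
  simp only [hg.flatMulti_sharp]
  rw [← apply_eq_sum_wedgeList e Y θ]
  simp only [mul_comm]

/-- The metric adjoint of the derivation `α ∧ i_v` is the derivation `v^♭ ∧ i_{α^♯}`. -/
theorem IsLorentz.formInner_hatForm_flatMulti (hg : IsLorentz d g) (e : Module.Basis (Fin d) ℝ V)
    {k : ℕ} (Y : Form V k →L[ℝ] ℝ) (θ : Form V k) (α : CoV V) (v : V) :
    formInner e g θ (hatForm α v (flatMulti e g Y))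
      = Y (hatForm (g.flat v) (sharp e g α) θ) := by
  have h := hg.formInner_flatMulti_comp e Y θ α v
  rw [Form.comp_rankOne, Form.comp_rankOne, map_add, ← hg.formInner_flatMulti e Y θ] at h
  have h2 : ∀ η η' : Form V k, formInner e g θ (η + η') = formInner e g θ η + formInner e g θ η' := by
    intro η η'
    simp only [formInner_eq_sum, ContinuousAlternatingMap.add_apply, mul_add, Finset.sum_add_distrib]
  rw [h2] at h
  linarith

end Metric

/-! ### Linearity of the metric operations -/

section Linearity

variable {V : Type*} [NormedAddCommGroup V] [NormedSpace ℝ V]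

theorem wedge_add {k : ℕ} (α : CoV V) (θ η : Form V k) :
    wedge α (θ + η) = wedge α θ + wedge α η := by
  ext z
  simp [wedge_apply, mul_add, Finset.sum_add_distrib]

theorem wedge_smul {k : ℕ} (α : CoV V) (r : ℝ) (θ : Form V k) :
    wedge α (r • θ) = r • wedge α θ := by
  ext z
  simp only [wedge_apply, ContinuousAlternatingMap.smul_apply, smul_eq_mul, Finset.mul_sum]
  refine Finset.sum_congr rfl fun i _ => ?_
  ring

theorem interior_add {k : ℕ} (v : V) (θ η : Form V (k + 1)) :
    interior v (θ + η) = interior v θ + interior v η := rfl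

theorem interior_smul {k : ℕ} (v : V) (r : ℝ) (θ : Form V (k + 1)) :
    interior v (r • θ) = r • interior v θ := rfl

theorem interior_smul_vector {k : ℕ} (v : V) (r : ℝ) (θ : Form V (k + 1)) :
    interior (r • v) θ = r • interior v θ := map_smul _ _ _

theorem hatForm_smul_vector {k : ℕ} (α : CoV V) (v : V) (r : ℝ) (θ : Form V k) :
    hatForm α (r • v) θ = r • hatForm α v θ := by
  cases k with
  | zero => simp [hatForm]
  | succ k => simp only [hatForm, interior_smul_vector, wedge_smul]

theorem toCoV_add (θ η : Form V 1) : toCoV (θ + η) = toCoV θ + toCoV η := rfl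

theorem toCoV_smul (r : ℝ) (θ : Form V 1) : toCoV (r • θ) = r • toCoV θ := rfl

variable {d : ℕ}

theorem sharp_add (e : Module.Basis (Fin d) ℝ V) (g : SymForm V) (α β : CoV V) :
    sharp e g (α + β) = sharp e g α + sharp e g β := by
  simp [sharp, mul_add, add_smul, Finset.sum_add_distrib]

theorem sharp_smul (e : Module.Basis (Fin d) ℝ V) (g : SymForm V) (r : ℝ) (α : CoV V) :
    sharp e g (r • α) = r • sharp e g α := by
  simp only [sharp, smul_apply, smul_eq_mul, Finset.smul_sum, smul_smul]
  refine Finset.sum_congr rfl fun i _ => Finset.sum_congr rfl fun j _ => ?_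
  congr 1
  ring

variable [FiniteDimensional ℝ V]

theorem hodge_add (e : Module.Basis (Fin d) ℝ V) (g : SymForm V) {k l : ℕ} (h : d = l + k)
    (θ η : Form V k) : hodge e g h (θ + η) = hodge e g h θ + hodge e g h η := by
  simp [hodge, add_smul, Finset.sum_add_distrib]

theorem hodge_smul (e : Module.Basis (Fin d) ℝ V) (g : SymForm V) {k l : ℕ} (h : d = l + k)
    (r : ℝ) (θ : Form V k) : hodge e g h (r • θ) = r • hodge e g h θ := by
  simp only [hodge, ContinuousAlternatingMap.smul_apply, smul_eq_mul, mul_smul, Finset.smul_sum]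
  refine Finset.sum_congr rfl fun i _ => ?_
  rw [smul_comm]

/-- Linear statements about forms need only be checked on products `x_1^♭ ∧ … ∧ x_k^♭`. -/
theorem IsLorentz.form_induction {g : SymForm V} (hg : IsLorentz d g)
    (e : Module.Basis (Fin d) ℝ V) {k : ℕ} {p : Form V k → Prop}
    (add : ∀ θ η, p θ → p η → p (θ + η)) (smul : ∀ (r : ℝ) θ, p θ → p (r • θ))
    (prod : ∀ x : Fin k → V, p (wedgeList k fun i => g.flat (x i))) (θ : Form V k) : p θ := by
  rw [form_eq_sum_wedgeList e θ]
  have zero : p 0 := by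
    simpa using smul 0 _ (prod 0)
  refine smul _ _ (Finset.sum_induction _ p add zero fun a _ => smul _ _ ?_)
  have h := prod fun i => sharp e g (coframe e (a i))
  simpa only [hg.flat_sharp] using h

end Linearity

/-! ### The Hodge star on products of covectors -/

section Hodge

variable {V : Type*} [NormedAddCommGroup V] [NormedSpace ℝ V] {k : ℕ} {g : SymForm V}

@[simp]
theorem wedgeList_two (α β : CoV V) (x y : V) :
    wedgeList 2 ![α, β] ![x, y] = α x * β y - α y * β x := by
  rw [wedgeList_apply, Matrix.det_fin_two]
  simp

/-- Moving `k` contracted vectors past three free slots costs the sign `(-1)^(3k)`. -/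
theorem contract_three (y : Fin k → V) (θ : Form V (3 + k)) (p q r : V) :
    contract k y θ ![p, q, r] = (-1) ^ k *
      reindex (Nat.add_comm 3 k) θ
        (Matrix.vecCons p (Matrix.vecCons q (Matrix.vecCons r y))) := by
  induction k with
  | zero =>
    change θ _ = _ * θ _
    rw [pow_zero, one_mul]
    congr 1
    funext i
    fin_cases i <;> rfl
  | succ k ih =>
    change contract k (fun i => y i.succ) (interior (k := 3 + k) (y 0) θ) ![p, q, r] = _
    rw [ih]
    set θ' : Form V (k + 4) := reindex (Nat.add_comm 3 (k + 1)) θ with hθ'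
    have h1 : reindex (Nat.add_comm 3 k) (interior (k := 3 + k) (y 0) θ)
        (Matrix.vecCons p (Matrix.vecCons q (Matrix.vecCons r fun i => y i.succ)))
        = θ' (Matrix.vecCons (y 0) (Matrix.vecCons p (Matrix.vecCons q (Matrix.vecCons r
          fun i => y i.succ)))) := by
      change θ _ = θ _
      congr 1
      funext i
      refine Fin.cases ?_ (fun i => ?_) (i : Fin (3 + k + 1))
      · rfl
      · rfl
    have h2 : (y : Fin (k + 1) → V) = Matrix.vecCons (y 0) fun i => y i.succ :=
      (Fin.cons_self_tail y).symm
    have h3 : θ' (Matrix.vecCons (y 0) (Matrix.vecCons p (Matrix.vecCons q (Matrix.vecCons r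
          fun i => y i.succ))))
        = -θ' (Matrix.vecCons p (Matrix.vecCons q (Matrix.vecCons r y))) := by
      conv_rhs => rw [h2]
      rw [vecCons_swap, ← interior_apply p, vecCons_swap, ← interior_apply q, vecCons_swap]
      simp
    rw [h1, h3, pow_succ]
    ring

variable [FiniteDimensional ℝ V]

/-- `⋆(a^♭ ∧ b^♭) = μ(a, b, ·)`. -/
theorem IsLorentz.hodge_two (hg : IsLorentz (k + 3) g) (e : Module.Basis (Fin (k + 3)) ℝ V)
    (h : k + 3 = k + 1 + 2) (a b : V) (z : Fin (k + 1) → V) :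
    hodge (l := k + 1) e g h (wedgeList 2 ![g.flat a, g.flat b]) z
      = vol e g (Matrix.vecCons a (Matrix.vecCons b z)) := by
  let G : V [⋀^Fin 2]→ₗ[ℝ] ℝ :=
    { toFun := fun v => vol e g (Matrix.vecCons (v 0) (Matrix.vecCons (v 1) z))
      map_update_add' := by
        intro _ m i x y
        have h1 := (vol e g).toAlternatingMap.map_vecCons_add
          (Matrix.vecCons (m 1) z) x y
        have h2 := (interior (m 0) (vol e g)).toAlternatingMap.map_vecCons_add z x y
        fin_cases i
        · simpa using h1
        · simpa using h2
      map_update_smul' := by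
        intro _ m i r x
        have h1 := (vol e g).toAlternatingMap.map_vecCons_smul
          (Matrix.vecCons (m 1) z) r x
        have h2 := (interior (m 0) (vol e g)).toAlternatingMap.map_vecCons_smul z r x
        fin_cases i
        · simpa using h1
        · simpa using h2
      map_eq_zero_of_eq' := by
        intro v i j hv hij
        have h1 : v 0 = v 1 := by
          fin_cases i <;> fin_cases j <;> simp_all
        refine (vol e g).map_eq_zero_of_eq _ (i := 0) (j := 1) ?_ (by simp)
        simpa using h1 }
  have h1 := sum_wedgeList_coframe_smul e G ![a, b]
  have h2 : ∀ r : Fin 2 → Fin (k + 3), wedgeList 2 ![g.flat a, g.flat b]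
      (fun i => sharp e g (coframe e (r i))) = wedgeList 2 (fun i => coframe e (r i)) ![a, b] := by
    intro r
    rw [wedgeList_apply, wedgeList_apply, ← Matrix.det_transpose]
    congr 1
    ext i j
    simp only [Matrix.transpose_apply, Matrix.of_apply]
    rw [← hg.eval_sharp e (coframe e (r i)), g.eval_comm]
    fin_cases j <;> rfl
  simp only [hodge, ContinuousAlternatingMap.smul_apply, ContinuousAlternatingMap.sum_apply,
    smul_eq_mul, h2]
  have h3 : ∀ r : Fin 2 → Fin (k + 3), contract 2 (fun i => e (r i)) (reindex h (vol e g)) z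
      = G fun i => e (r i) := fun r => rfl
  simp only [h3]
  simp only [smul_eq_mul] at h1
  rw [h1]
  change _ * (_ * vol e g _) = _
  simp [Nat.factorial]

/-- `⋆Y^♭` on three vectors. -/
theorem IsLorentz.hodge_flatMulti (hg : IsLorentz (k + 3) g)
    (e : Module.Basis (Fin (k + 3)) ℝ V) (h : k + 3 = 3 + k) (Y : Form V k →L[ℝ] ℝ) (p q r : V) :
    hodge (l := 3) e g h (flatMulti e g Y) ![p, q, r]
      = (-1) ^ k * Y (interior r (interior q (interior p (vol e g)))) := by
  rw [← apply_eq_sum_wedgeList e Y]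
  simp only [hodge, ContinuousAlternatingMap.smul_apply, ContinuousAlternatingMap.sum_apply,
    smul_eq_mul, hg.flatMulti_sharp]
  rw [mul_left_comm ((-1 : ℝ) ^ k), Finset.mul_sum _ _ ((-1 : ℝ) ^ k)]
  congr 1
  refine Finset.sum_congr rfl fun a _ => ?_
  rw [contract_three, mul_left_comm]
  rfl

end Hodge

/-! ### Spatial forms -/

section Spatial

variable {V : Type*} [NormedAddCommGroup V] [NormedSpace ℝ V] {k : ℕ} {g : SymForm V}

/-- A functional that annihilates the forms `u^♭ ∧ i_u θ` sees only the values of a form on the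
vectors orthogonal to `u`. -/
theorem apply_eq_zero_of_spatial {u : V} {c : ℝ} (hc : c ≠ 0) (hu : g.eval u u = -c ^ 2)
    (Y : Form V k →L[ℝ] ℝ) (hY : ∀ θ, Y (hatForm (g.flat u) u θ) = 0) (θ : Form V k)
    (hθ : ∀ y : Fin k → V, (∀ i, g.eval u (y i) = 0) → θ y = 0) : Y θ = 0 := by
  have h := θ.comp_rankOne (g.flat u) ((1 / c ^ 2) • u)
  have h2 : θ.comp (ContinuousLinearMap.id ℝ V + (g.flat u).smulRight ((1 / c ^ 2) • u)) = 0 := by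
    ext y
    refine hθ _ fun i => ?_
    simp [SymForm.eval_add_right, SymForm.eval_smul_right, hu]
    field_simp
    ring
  have h3 := congrArg Y h
  rw [h2, map_zero, hatForm_smul_vector, map_add, map_smul, hY] at h3
  simpa using h3.symm

end Spatial

/-! ### The magnetic part of the stress -/

section Magnetic

variable {V : Type*} [NormedAddCommGroup V] [NormedSpace ℝ V] [FiniteDimensional ℝ V]
  {k : ℕ} {g : SymForm V}

/-- The derivation `θ ↦ λ ∧ i_p θ` on a top-degree form, with the first three slots made explicit. -/
theorem top_expansion [hd : Fact (Module.finrank ℝ V = k + 3)] (μ : Form V (k + 3)) (lam : CoV V)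
    (p a b u : V) (y : Fin k → V) :
    lam p * μ (Matrix.vecCons a (Matrix.vecCons b (Matrix.vecCons u y)))
      = lam a * μ (Matrix.vecCons p (Matrix.vecCons b (Matrix.vecCons u y)))
        + lam b * μ (Matrix.vecCons a (Matrix.vecCons p (Matrix.vecCons u y)))
        + lam u * μ (Matrix.vecCons a (Matrix.vecCons b (Matrix.vecCons p y)))
        + hatForm lam p (interior u (interior b (interior a μ))) y := by
  have h := congrArg (fun η : Form V (k + 3) =>
    η (Matrix.vecCons a (Matrix.vecCons b (Matrix.vecCons u y)))) (hatForm_top hd.out lam p μ)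
  simp only [hatForm_vecCons, ContinuousAlternatingMap.smul_apply, smul_eq_mul,
    interior_apply] at h
  rw [← h]
  ring

/-- The pointwise identity behind the magnetic stress, on vectors `y` orthogonal to `u`.  It is linear
in `F`; for `F = a^♭ ∧ b^♭` it is the sum of three instances of `top_expansion`. -/
theorem IsLorentz.magnetic_identity_apply [Fact (Module.finrank ℝ V = k + 3)]
    (hg : IsLorentz (k + 3) g) (e : Module.Basis (Fin (k + 3)) ℝ V) (h : k + 3 = k + 1 + 2)
    {u : V} {c : ℝ} (hc : c ≠ 0) (hu : g.eval u u = -c ^ 2) (p v : V) (y : Fin k → V)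
    (hy : ∀ i, g.eval u (y i) = 0) (F : Form V 2) :
    -hodge (l := k + 1) e g h (wedge (g.flat p) (interior v F)) (Matrix.vecCons u y)
      + g.eval p u * hodge (l := k + 1) e g h F (Matrix.vecCons v y)
      + 2 / c ^ 2 * (g.eval p u * g.eval u v) * hodge (l := k + 1) e g h F (Matrix.vecCons u y)
      + 1 / c ^ 2 * (g.eval p u * vol e g (Matrix.vecCons u (Matrix.vecCons
            (sharp e g (toCoV (interior u F))) (Matrix.vecCons v y)))
          + g.eval u v * vol e g (Matrix.vecCons u (Matrix.vecCons
            (sharp e g (toCoV (interior u F))) (Matrix.vecCons p y))))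
      - hatForm (g.flat v) p (interior u (hodge (l := k + 1) e g h F)) y
      + g.eval p v * hodge (l := k + 1) e g h F (Matrix.vecCons u y) = 0 := by
  set μ := vol e g with hμ
  have hadd : ∀ (x : V) (α β : CoV V),
      μ (Matrix.vecCons u (Matrix.vecCons (sharp e g (α + β)) (Matrix.vecCons x y)))
        = μ (Matrix.vecCons u (Matrix.vecCons (sharp e g α) (Matrix.vecCons x y)))
          + μ (Matrix.vecCons u (Matrix.vecCons (sharp e g β) (Matrix.vecCons x y))) := by
    intro x α β
    rw [sharp_add]
    exact (interior u μ).toAlternatingMap.map_vecCons_add (Matrix.vecCons x y) _ _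
  have hsmul : ∀ (x : V) (r : ℝ) (α : CoV V),
      μ (Matrix.vecCons u (Matrix.vecCons (sharp e g (r • α)) (Matrix.vecCons x y)))
        = r * μ (Matrix.vecCons u (Matrix.vecCons (sharp e g α) (Matrix.vecCons x y))) := by
    intro x r α
    rw [sharp_smul]
    exact (interior u μ).toAlternatingMap.map_vecCons_smul (Matrix.vecCons x y) _ _
  induction F using hg.form_induction e with
  | add F F' hF hF' =>
    simp only [interior_add, wedge_add, hodge_add, toCoV_add, hadd, hatForm_add,
      ContinuousAlternatingMap.add_apply]
    linear_combination hF + hF'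
  | smul r F hF =>
    simp only [interior_smul, wedge_smul, hodge_smul, toCoV_smul, hsmul, hatForm_smul,
      ContinuousAlternatingMap.smul_apply, smul_eq_mul]
    linear_combination r * hF
  | prod x =>
    obtain ⟨a, b, rfl⟩ : ∃ a b, x = ![a, b] := ⟨x 0, x 1, by
      funext i
      fin_cases i <;> rfl⟩
    have hF : (wedgeList 2 fun i => g.flat ((![a, b] : Fin 2 → V) i))
        = wedgeList 2 ![g.flat a, g.flat b] := by
      congr 1
      funext i
      fin_cases i <;> rfl
    have hE : toCoV (interior u (wedgeList 2 ![g.flat a, g.flat b]))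
        = g.eval a u • g.flat b + (-g.eval b u) • g.flat a := by
      ext z
      simp
      ring
    have hW : wedge (g.flat p) (interior v (wedgeList 2 ![g.flat a, g.flat b]))
        = g.eval a v • wedgeList 2 ![g.flat p, g.flat b]
          + (-g.eval b v) • wedgeList 2 ![g.flat p, g.flat a] := by
      ext z
      obtain ⟨z₀, z₁, rfl⟩ : ∃ z₀ z₁, z = ![z₀, z₁] := ⟨z 0, z 1, by
        funext i
        fin_cases i <;> rfl⟩
      have h1 : (fun j : Fin 1 => (![z₀, z₁] : Fin 2 → V) ((0 : Fin 2).succAbove j)) = ![z₁] := by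
        funext j
        fin_cases j
        rfl
      have h2 : (fun j : Fin 1 => (![z₀, z₁] : Fin 2 → V) ((1 : Fin 2).succAbove j)) = ![z₀] := by
        funext j
        fin_cases j
        rfl
      rw [wedge_apply, Fin.sum_univ_two, h1, h2]
      simp
      ring
    have hB : interior u (hodge (l := k + 1) e g h (wedgeList 2 ![g.flat a, g.flat b]))
        = interior u (interior b (interior a μ)) := by
      ext z
      exact hg.hodge_two e h a b _
    rw [hF, hE, hW, hB]
    simp only [hadd, hsmul, hodge_add, hodge_smul, hg.sharp_flat,
      ContinuousAlternatingMap.add_apply, ContinuousAlternatingMap.smul_apply, smul_eq_mul,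
      hg.hodge_two, ← hμ]
    -- `λ = v^♭` removes the derivation of `B`; `λ = u^♭` expresses the terms in which `u` is replaced by
    -- `p` or `v`, its derivation vanishing because `y` is orthogonal to `u`
    have t1 := top_expansion μ (g.flat v) p a b u y
    have t2 := top_expansion μ (g.flat u) p a b u y
    have t3 := top_expansion μ (g.flat u) v a b u y
    rw [hatForm_apply_eq_zero (g.flat u) _ _ y hy] at t2 t3
    simp only [SymForm.flat_apply, hu] at t1 t2 t3
    rw [g.eval_comm v p, g.eval_comm v a, g.eval_comm v b, g.eval_comm v u] at t1
    rw [g.eval_comm u p, g.eval_comm u a, g.eval_comm u b] at t2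
    rw [g.eval_comm u a, g.eval_comm u b] at t3
    -- every transposition among the first three slots changes the sign
    have s12 : ∀ x₁ x₂ x₃ : V, μ (Matrix.vecCons x₁ (Matrix.vecCons x₂ (Matrix.vecCons x₃ y)))
        = -μ (Matrix.vecCons x₂ (Matrix.vecCons x₁ (Matrix.vecCons x₃ y))) :=
      fun x₁ x₂ x₃ => vecCons_swap μ _ _ _
    have s23 : ∀ x₁ x₂ x₃ : V, μ (Matrix.vecCons x₁ (Matrix.vecCons x₂ (Matrix.vecCons x₃ y)))
        = -μ (Matrix.vecCons x₁ (Matrix.vecCons x₃ (Matrix.vecCons x₂ y))) :=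
      fun x₁ x₂ x₃ => vecCons_swap (interior x₁ μ) _ _ _
    rw [s12 a p u] at t1 t2
    rw [s12 a v u] at t3
    rw [s12 u b v, s23 b u v, s12 b v u, s12 u a v, s23 a u v, s12 a v u,
      s12 u b p, s23 b u p, s12 b p u, s12 u a p, s23 a u p, s12 a p u]
    have hc2 : c ^ 2 ≠ 0 := pow_ne_zero 2 hc
    field_simp
    linear_combination c ^ 2 * t1 + g.eval u v * t2 + g.eval p u * t3

/-- The magnetic part of the stress: here `Y` is `∂ε/∂B`, and the left side collects the variations of
`B = -c⁻¹ i_u ⋆F` under those of `F` and `u`. -/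
theorem IsLorentz.magnetic_identity [Fact (Module.finrank ℝ V = k + 3)]
    (hg : IsLorentz (k + 3) g) (e : Module.Basis (Fin (k + 3)) ℝ V) (h : k + 3 = k + 1 + 2)
    (h' : k + 3 = 3 + k) {u : V} {c : ℝ} (hc : c ≠ 0) (hu : g.eval u u = -c ^ 2)
    (Y : Form V k →L[ℝ] ℝ) (hY : ∀ θ, Y (hatForm (g.flat u) u θ) = 0) (F : Form V 2) (E S : CoV V)
    (B : Form V k) (hE : E = (-(1 / c)) • toCoV (interior u F))
    (hB : B = (-(1 / c)) • interior u (hodge (l := k + 1) e g h F))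
    (hS : S = ((-1) ^ (k + 2) * (1 / c)) • toCoV (interior (sharp e g E)
      (interior u (hodge (l := 3) e g h' (flatMulti e g Y))))) (α : CoV V) (v : V) :
    -(1 / c) * Y (interior u (hodge (l := k + 1) e g h (wedge α (interior v F))))
        + 1 / c * α u * Y (interior v (hodge (l := k + 1) e g h F))
        - 1 / c ^ 2 * (α u * g.eval u v) * Y B
      = 1 / c * (α u * S v + α (sharp e g S) * g.eval u v)
        - formInner e g B (hatForm α v (flatMulti e g Y))
        + Y B * (α v + 1 / c ^ 2 * (α u * g.eval u v)) := by
  set p := sharp e g α with hp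
  have hα : g.flat p = α := hg.flat_sharp e α
  have hαu : g.eval p u = α u := hg.eval_sharp e α u
  have hαv : g.eval p v = α v := hg.eval_sharp e α v
  set Q := sharp e g (toCoV (interior u F)) with hQ
  have hSx : ∀ x, S x = -(1 / c ^ 2) * Y (interior x (interior Q (interior u (vol e g)))) := by
    intro x
    have hsE : sharp e g E = (-(1 / c)) • Q := by rw [hE, sharp_smul]
    rw [hS]
    have h1 := hg.hodge_flatMulti e h' Y u (sharp e g E) x
    have h0 : toCoV (interior (sharp e g E) (interior u (hodge (l := 3) e g h'
        (flatMulti e g Y)))) x = hodge (l := 3) e g h' (flatMulti e g Y) ![u, sharp e g E, x] :=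
      toCoV_apply _ _
    have h2 : interior x (interior ((-(1 / c)) • Q) (interior u (vol e g)))
        = (-(1 / c)) • interior x (interior Q (interior u (vol e g))) := by
      rw [interior_smul_vector, interior_smul]
    have h3 : ((-1 : ℝ) ^ k) * (-1) ^ k = 1 := by
      rw [← mul_pow]
      norm_num
    rw [smul_apply, h0, h1, hsE, h2, map_smul, smul_eq_mul, smul_eq_mul]
    field_simp
    rw [pow_add]
    linear_combination -(Y (interior x (interior Q (interior u (vol e g))))) * h3
  rw [hg.apply_sharp_comm e α S, ← hp, hSx, hSx, hg.formInner_hatForm_flatMulti, ← hp, hB,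
    hatForm_smul, map_smul, map_smul]
  have key := apply_eq_zero_of_spatial hc hu Y hY
    ((-1 : ℝ) • interior u (hodge (l := k + 1) e g h (wedge (g.flat p) (interior v F)))
      + (g.eval p u) • interior v (hodge (l := k + 1) e g h F)
      + (2 / c ^ 2 * (g.eval p u * g.eval u v)) • interior u (hodge (l := k + 1) e g h F)
      + (1 / c ^ 2) • (g.eval p u • interior v (interior Q (interior u (vol e g)))
          + g.eval u v • interior p (interior Q (interior u (vol e g))))
      + (-1 : ℝ) • hatForm (g.flat v) p (interior u (hodge (l := k + 1) e g h F))
      + g.eval p v • interior u (hodge (l := k + 1) e g h F))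
    (by
      intro y hy
      have h1 := hg.magnetic_identity_apply e h hc hu p v y hy F
      simp only [ContinuousAlternatingMap.add_apply, ContinuousAlternatingMap.smul_apply,
        smul_eq_mul, interior_apply]
      linear_combination h1)
  simp only [map_add, map_smul, smul_eq_mul, hα, hαu, hαv] at key ⊢
  field_simp at key ⊢
  linear_combination key

end Magnetic

/-! ### Derivatives of the Lagrangian density -/

section Calculus

open Filter Topology

variable {V : Type*} [NormedAddCommGroup V] [NormedSpace ℝ V] [FiniteDimensional ℝ V]
  {k : ℕ} [Fact (Module.finrank ℝ V = k + 3)]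

/-- The differential of a function of five variables in terms of its partial derivatives. -/
theorem exists_hasFDerivAt_partials {X Y Z : Type*} [NormedAddCommGroup X] [NormedSpace ℝ X]
    [NormedAddCommGroup Y] [NormedSpace ℝ Y] [NormedAddCommGroup Z] [NormedSpace ℝ Z]
    (f : ℝ → ℝ → X → Y → Z → ℝ) (r s : ℝ) (x : X) (y : Y) (z : Z)
    (h : DifferentiableAt ℝ (fun p : ℝ × ℝ × X × Y × Z =>
      f p.1 p.2.1 p.2.2.1 p.2.2.2.1 p.2.2.2.2) (r, s, x, y, z)) :
    ∃ D : ℝ × ℝ × X × Y × Z →L[ℝ] ℝ,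
      HasFDerivAt (fun p : ℝ × ℝ × X × Y × Z => f p.1 p.2.1 p.2.2.1 p.2.2.2.1 p.2.2.2.2) D
        (r, s, x, y, z) ∧
      ∀ r' s' x' y' z', D (r', s', x', y', z')
        = r' * deriv (fun r => f r s x y z) r + s' * deriv (fun s => f r s x y z) s
          + fderiv ℝ (fun x => f r s x y z) x x' + fderiv ℝ (fun y => f r s x y z) y y'
          + fderiv ℝ (fun z => f r s x y z) z z' := by
  obtain ⟨D, hD⟩ := h
  refine ⟨D, hD, fun r' s' x' y' z' => ?_⟩
  have c1 : HasDerivAt (fun r : ℝ => (r, s, x, y, z)) (1, 0) r :=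
    (hasDerivAt_id _).prodMk (hasDerivAt_const _ _)
  have c2 : HasDerivAt (fun s : ℝ => (r, s, x, y, z)) (0, 1, 0) s :=
    (hasDerivAt_const _ _).prodMk ((hasDerivAt_id _).prodMk (hasDerivAt_const _ _))
  have c3 := (hasFDerivAt_id (𝕜 := ℝ) x).prodMk (hasFDerivAt_const (y, z) x)
  replace c3 := (hasFDerivAt_const s x).prodMk c3
  replace c3 := (hasFDerivAt_const r x).prodMk c3
  have c4 := (hasFDerivAt_id (𝕜 := ℝ) y).prodMk (hasFDerivAt_const z y)
  replace c4 := (hasFDerivAt_const x y).prodMk c4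
  replace c4 := (hasFDerivAt_const s y).prodMk c4
  replace c4 := (hasFDerivAt_const r y).prodMk c4
  have c5 := (hasFDerivAt_const (𝕜 := ℝ) y z).prodMk (hasFDerivAt_id z)
  replace c5 := (hasFDerivAt_const x z).prodMk c5
  replace c5 := (hasFDerivAt_const s z).prodMk c5
  replace c5 := (hasFDerivAt_const r z).prodMk c5
  let f' : ℝ × ℝ × X × Y × Z → ℝ := fun p => f p.1 p.2.1 p.2.2.1 p.2.2.2.1 p.2.2.2.2
  have h1 : deriv (fun r => f r s x y z) r = D (1, 0) :=
    (HasFDerivAt.comp_hasDerivAt r (l := f') hD c1).deriv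
  have h2 : deriv (fun s => f r s x y z) s = D (0, 1, 0) :=
    (HasFDerivAt.comp_hasDerivAt s (l := f') hD c2).deriv
  have h3 : fderiv ℝ (fun x => f r s x y z) x x' = D (0, 0, x', 0) :=
    congrArg (fun T : X →L[ℝ] ℝ => T x') (HasFDerivAt.comp x (g := f') hD c3).fderiv
  have h4 : fderiv ℝ (fun y => f r s x y z) y y' = D (0, 0, 0, y', 0) :=
    congrArg (fun T : Y →L[ℝ] ℝ => T y') (HasFDerivAt.comp y (g := f') hD c4).fderiv
  have h5 : fderiv ℝ (fun z => f r s x y z) z z' = D (0, 0, 0, 0, z') :=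
    congrArg (fun T : Z →L[ℝ] ℝ => T z') (HasFDerivAt.comp z (g := f') hD c5).fderiv
  have h6 : (r', s', x', y', z') = r' • ((1, 0) : ℝ × ℝ × X × Y × Z)
      + s' • (0, 1, 0) + (0, 0, x', 0) + (0, 0, 0, y', 0) + (0, 0, 0, 0, z') := by
    simp
  rw [h1, h2, h3, h4, h5, h6]
  simp only [map_add, map_smul, smul_eq_mul]

theorem EnergyF.DiffAt.hasFDerivAt {o : Orient (k + 3) V} {c : ℝ} {𝔢 : EnergyF V}
    {φ : EMState (k + 3) V} (h : 𝔢.DiffAt o c φ) :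
    ∃ D : ℝ × ℝ × V × Form V 2 × SymForm V →L[ℝ] ℝ,
      HasFDerivAt (fun p : ℝ × ℝ × V × Form V 2 × SymForm V =>
        𝔢 p.1 p.2.1 p.2.2.1 p.2.2.2.1 p.2.2.2.2 φ.g) D
        (φ.ρ o c, φ.s o c, φ.u c, φ.F, φ.cauchy) ∧
      ∀ r s v F b, D (r, s, v, F, b) = r * 𝔢.dρ o c φ + s * 𝔢.ds o c φ + 𝔢.du o c φ v
        + 𝔢.dF o c φ F + 𝔢.dcauchy o c φ b :=
  exists_hasFDerivAt_partials (fun r s u F b => 𝔢 r s u F b φ.g) _ _ _ _ _ h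

theorem EnergyEB.DiffAt.hasFDerivAt {o : Orient (k + 3) V} {c : ℝ} {ε : EnergyEB k V}
    {φ : EMState (k + 3) V} (h : ε.DiffAt o c φ) :
    ∃ D : ℝ × ℝ × CoV V × Form V k × SymForm V →L[ℝ] ℝ,
      HasFDerivAt (fun p : ℝ × ℝ × CoV V × Form V k × SymForm V =>
        ε p.1 p.2.1 p.2.2.1 p.2.2.2.1 p.2.2.2.2 φ.g) D
        (φ.ρ o c, φ.s o c, φ.E c, φ.B o c, φ.cauchy) ∧
      ∀ r s E B b, D (r, s, E, B, b) = r * ε.dρ o c φ + s * ε.ds o c φ + ε.dE o c φ E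
        + ε.dB o c φ B + ε.dcauchy o c φ b :=
  exists_hasFDerivAt_partials (fun r s E B b => ε r s E B b φ.g) _ _ _ _ _ h

/-- The chain rule for `ℓ = -𝔢 μ(g) - q ρ (A·u) μ(g)` along a family of states with fixed metric. -/
theorem HasFormF.fderiv_apply {o : Orient (k + 3) V} {c q : ℝ} {ℓ : Lagrangian (k + 3) V}
    {𝔢 : EnergyF V} (hℓ : HasFormF o c q ℓ 𝔢) {φ : EMState (k + 3) V} (h : 𝔢.DiffAt o c φ)
    {X : Type*} [NormedAddCommGroup X] [NormedSpace ℝ X] (γ : X → EMState (k + 3) V) (x₀ : X)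
    (hγ : γ x₀ = φ) (hγg : ∀ x, (γ x).g = φ.g) (ht : ∀ᶠ x in 𝓝 x₀, (γ x).Timelike)
    {A' : X →L[ℝ] CoV V} {F' : X →L[ℝ] Form V 2} {ρ' s' : X →L[ℝ] ℝ} {u' : X →L[ℝ] V}
    {b' : X →L[ℝ] SymForm V} (hA : HasFDerivAt (fun x => (γ x).A) A' x₀)
    (hF : HasFDerivAt (fun x => (γ x).F) F' x₀) (hρ : HasFDerivAt (fun x => (γ x).ρ o c) ρ' x₀)
    (hs : HasFDerivAt (fun x => (γ x).s o c) s' x₀) (hu : HasFDerivAt (fun x => (γ x).u c) u' x₀)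
    (hb : HasFDerivAt (fun x => (γ x).cauchy) b' x₀) (δ : X) :
    fderiv ℝ (fun x => ℓ (γ x)) x₀ δ
      = (-(ρ' δ * 𝔢.dρ o c φ + s' δ * 𝔢.ds o c φ + 𝔢.du o c φ (u' δ) + 𝔢.dF o c φ (F' δ)
            + 𝔢.dcauchy o c φ (b' δ))
          - q * (ρ' δ * φ.A (φ.u c) + φ.ρ o c * (A' δ (φ.u c) + φ.A (u' δ)))) • φ.μ o := by
  obtain ⟨D, hD, hD'⟩ := h.hasFDerivAt
  have hμ : ∀ x, (γ x).μ o = φ.μ o := by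
    intro x
    simp only [EMState.μ, hγg]
  have heq : (fun x => ℓ (γ x)) =ᶠ[𝓝 x₀] fun x =>
      (-𝔢 ((γ x).ρ o c) ((γ x).s o c) ((γ x).u c) (γ x).F (γ x).cauchy φ.g
        - q * ((γ x).ρ o c * (γ x).A ((γ x).u c))) • φ.μ o := by
    filter_upwards [ht] with x hx
    rw [hℓ _ hx, hμ, hγg, ← sub_smul, mul_assoc]
  subst hγ
  have h1 := hD.comp x₀ (hρ.prodMk (hs.prodMk (hu.prodMk (hF.prodMk hb))))
  have h2 := hρ.mul (hA.clm_apply hu)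
  have h3 := (h1.neg.sub (h2.const_mul q)).smul_const ((γ x₀).μ o)
  have h4 := (h3.congr_of_eventuallyEq heq).fderiv
  rw [h4]
  simp only [ContinuousLinearMap.smulRight_apply, sub_apply, neg_apply,
    ContinuousLinearMap.comp_apply, ContinuousLinearMap.prod_apply, hD', smul_apply, smul_eq_mul,
    add_apply, ContinuousLinearMap.flip_apply]
  congr 1
  ring

end Calculus

/-! ### The stress tensor for `𝔢(ρ, s, u, F, 𝖼, g)` -/

section Stress

open Filter Topology

variable {V : Type*} [NormedAddCommGroup V] [NormedSpace ℝ V]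

/-- The tensor `κ̂` of a symmetric tensor is twice the symmetric product. -/
theorem hatSym_eq (α : CoV V) (v : V) (b : SymForm V) :
    hatSym α v b = (2 : ℝ) • symProd α (b.flat v) := by
  ext x y
  simp [hatSym, symProd]

theorem elasticI_apply {d : ℕ} (ℓ : Lagrangian d V) (φ : EMState d V) (α : CoV V) (v : V) :
    elasticI ℓ φ α v = (2 : ℝ) • ℓ.dcauchy φ (symProd α (φ.cauchy.flat v)) := rfl

section

variable {d : ℕ} {c : ℝ} {φ : EMState d V}

theorem EMState.Timelike.sqrt_pos (hφ : φ.Timelike) : 0 < Real.sqrt (-φ.g.eval φ.w φ.w) :=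
  Real.sqrt_pos.2 (by linarith [hφ.2])

theorem EMState.Timelike.eval_u (hφ : φ.Timelike) : φ.g.eval (φ.u c) (φ.u c) = -c ^ 2 := by
  have h := hφ.sqrt_pos
  have h2 := Real.sq_sqrt (show 0 ≤ -φ.g.eval φ.w φ.w by linarith [hφ.2])
  rw [EMState.u, SymForm.eval_smul_left, SymForm.eval_smul_right]
  field_simp
  linear_combination c ^ 2 * h2

/-- Being timelike is an open condition on `w`. -/
theorem EMState.Timelike.eventually (hφ : φ.Timelike) :
    ∀ᶠ w in 𝓝 φ.w, EMState.Timelike { φ with w := w } := by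
  have hcont : Continuous fun w : V => φ.g.eval w w :=
    (φ.g : V →L[ℝ] V →L[ℝ] ℝ).continuous.clm_apply continuous_id
  filter_upwards [hcont.continuousAt.eventually_lt continuousAt_const hφ.2] with w hw
  exact ⟨hφ.1, hw⟩

/-- The derivative of `√(-g(w,w))` with respect to `w`. -/
theorem EMState.Timelike.hasFDerivAt_sqrt (hφ : φ.Timelike) :
    HasFDerivAt (fun w => Real.sqrt (-φ.g.eval w w))
      ((-(1 / Real.sqrt (-φ.g.eval φ.w φ.w))) • φ.g.flat φ.w) φ.w := by
  have h1 : HasFDerivAt (fun w : V => φ.g.eval w w) _ φ.w :=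
    (φ.g : V →L[ℝ] V →L[ℝ] ℝ).hasFDerivAt.clm_apply (hasFDerivAt_id _)
  have h2 : HasFDerivAt (fun w : V => -φ.g.eval w w) _ φ.w := h1.neg
  have hne : -φ.g.eval φ.w φ.w ≠ 0 := by linarith [hφ.2]
  refine (h2.sqrt hne).congr_fderiv ?_
  have h := hφ.sqrt_pos
  ext v
  have h3 : (φ.g : V →L[ℝ] V →L[ℝ] ℝ) v φ.w = (φ.g : V →L[ℝ] V →L[ℝ] ℝ) φ.w v := φ.g.2 v φ.w
  simp [h3, SymForm.eval]
  field_simp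
  ring

/-- The derivative of a proper density with respect to `w`, with `r` the quotient by `μ(g)` of the
generalized density. -/
theorem EMState.Timelike.hasFDerivAt_proper (hφ : φ.Timelike) (r : ℝ) :
    HasFDerivAt (fun w => Real.sqrt (-φ.g.eval w w) / c * r)
      ((-(1 / Real.sqrt (-φ.g.eval φ.w φ.w)) / c * r) • φ.g.flat φ.w) φ.w := by
  have h := (hφ.hasFDerivAt_sqrt.mul_const (c⁻¹ * r))
  refine (h.congr_fderiv ?_).congr_of_eventuallyEq (Eventually.of_forall fun w => ?_)
  · ext v
    simp
    ring
  · simp only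
    ring

/-- The derivative of the world-velocity with respect to `w`. -/
theorem EMState.Timelike.hasFDerivAt_u (hφ : φ.Timelike) :
    HasFDerivAt (fun w => EMState.u c { φ with w := w })
      ((c / Real.sqrt (-φ.g.eval φ.w φ.w)) • ContinuousLinearMap.id ℝ V
        + ((c / Real.sqrt (-φ.g.eval φ.w φ.w) ^ 3) • φ.g.flat φ.w).smulRight φ.w) φ.w := by
  have h0 := hφ.sqrt_pos
  have h1 : HasFDerivAt (fun w => c / Real.sqrt (-φ.g.eval w w))
      ((c / Real.sqrt (-φ.g.eval φ.w φ.w) ^ 3) • φ.g.flat φ.w) φ.w := by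
    have h2 := ((hasDerivAt_inv h0.ne').comp_hasFDerivAt φ.w hφ.hasFDerivAt_sqrt).const_mul c
    refine (h2.congr_fderiv ?_).congr_of_eventuallyEq (Eventually.of_forall fun w => ?_)
    · ext v
      simp
      field_simp
    · exact div_eq_mul_inv _ _
  exact h1.smul (hasFDerivAt_id φ.w)

/-- The proper density is linear in the density. -/
theorem hasFDerivAt_properDensity (e : Module.Basis (Fin d) ℝ V) (N : ℝ)
    (μ θ : Form V d) :
    HasFDerivAt (fun r => N * ratio e r μ)
      ((N / μ e) • ContinuousAlternatingMap.apply ℝ V ℝ e) θ := by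
  refine (((N / μ e) • ContinuousAlternatingMap.apply ℝ V ℝ e).hasFDerivAt (x := θ)).congr_of_eventuallyEq
    (Eventually.of_forall fun r => ?_)
  simp [ratio, -mul_eq_mul_right_iff]
  ring

end

variable [FiniteDimensional ℝ V] {k : ℕ} [hd : Fact (Module.finrank ℝ V = k + 3)]

/-- The stress tensor of any Lagrangian density as fluid part minus elastic part. -/
theorem stressTensor_eq_sub_elasticI (ℓ : Lagrangian (k + 3) V) (φ : EMState (k + 3) V) :
    stressTensor ℓ φ = fluidStressI ℓ φ - elasticI ℓ φ := by
  funext α v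
  change _ = fluidStressI ℓ φ α v - elasticI ℓ φ α v
  rw [elasticI_apply, stressTensor, fluidStressI, hatSym_eq, hatForm_top hd.out,
    hatForm_top hd.out]
  simp only [map_smul, smul_sub]
  change _ - ℓ.dF φ (wedge α (interior v φ.F)) = _
  abel

variable {o : Orient (k + 3) V} {c q : ℝ} {ℓ : Lagrangian (k + 3) V} {𝔢 : EnergyF V}
  {φ : EMState (k + 3) V}

theorem HasFormF.dA_apply (hℓ : HasFormF o c q ℓ 𝔢) (h : 𝔢.DiffAt o c φ) (hφ : φ.Timelike)
    (δ : CoV V) : ℓ.dA φ δ = (-(q * φ.ρ o c * δ (φ.u c))) • φ.μ o := by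
  have := hℓ.fderiv_apply h (fun A => { φ with A := A }) φ.A rfl (fun _ => rfl)
    (Eventually.of_forall fun _ => hφ) (hasFDerivAt_id _) (hasFDerivAt_const φ.F _)
    (hasFDerivAt_const (φ.ρ o c) _) (hasFDerivAt_const (φ.s o c) _) (hasFDerivAt_const (φ.u c) _)
    (hasFDerivAt_const φ.cauchy _) δ
  refine this.trans ?_
  congr 1
  simp
  ring

theorem HasFormF.dF_apply (hℓ : HasFormF o c q ℓ 𝔢) (h : 𝔢.DiffAt o c φ) (hφ : φ.Timelike)
    (δ : Form V 2) : ℓ.dF φ δ = (-𝔢.dF o c φ δ) • φ.μ o := by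
  have := hℓ.fderiv_apply h (fun F => { φ with F := F }) φ.F rfl (fun _ => rfl)
    (Eventually.of_forall fun _ => hφ) (hasFDerivAt_const φ.A _) (hasFDerivAt_id _)
    (hasFDerivAt_const (φ.ρ o c) _) (hasFDerivAt_const (φ.s o c) _) (hasFDerivAt_const (φ.u c) _)
    (hasFDerivAt_const φ.cauchy _) δ
  refine this.trans ?_
  congr 1
  simp

theorem HasFormF.dcauchy_apply (hℓ : HasFormF o c q ℓ 𝔢) (h : 𝔢.DiffAt o c φ) (hφ : φ.Timelike)
    (δ : SymForm V) : ℓ.dcauchy φ δ = (-𝔢.dcauchy o c φ δ) • φ.μ o := by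
  have := hℓ.fderiv_apply h (fun b => { φ with cauchy := b }) φ.cauchy rfl (fun _ => rfl)
    (Eventually.of_forall fun _ => hφ) (hasFDerivAt_const φ.A _) (hasFDerivAt_const φ.F _)
    (hasFDerivAt_const (φ.ρ o c) _) (hasFDerivAt_const (φ.s o c) _) (hasFDerivAt_const (φ.u c) _)
    (hasFDerivAt_id _) δ
  refine this.trans ?_
  congr 1
  simp

theorem HasFormF.dmass_self (hℓ : HasFormF o c q ℓ 𝔢) (h : 𝔢.DiffAt o c φ) (hφ : φ.Timelike) :
    ℓ.dmass φ φ.mass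
      = (-(φ.ρ o c * 𝔢.dρ o c φ) - q * φ.ρ o c * φ.A (φ.u c)) • φ.μ o := by
  have hr := hasFDerivAt_properDensity (frame o) (Real.sqrt (-φ.g.eval φ.w φ.w) / c) (φ.μ o) φ.mass
  have := hℓ.fderiv_apply h (fun r => { φ with mass := r }) φ.mass rfl (fun _ => rfl)
    (Eventually.of_forall fun _ => hφ) (hasFDerivAt_const φ.A _) (hasFDerivAt_const φ.F _)
    hr (hasFDerivAt_const (φ.s o c) _) (hasFDerivAt_const (φ.u c) _)
    (hasFDerivAt_const φ.cauchy _) φ.mass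
  refine this.trans ?_
  congr 1
  simp [EMState.ρ, ratio, -mul_eq_mul_right_iff]
  ring

theorem HasFormF.dentropy_self (hℓ : HasFormF o c q ℓ 𝔢) (h : 𝔢.DiffAt o c φ)
    (hφ : φ.Timelike) : ℓ.dentropy φ φ.entropy = (-(φ.s o c * 𝔢.ds o c φ)) • φ.μ o := by
  have hr := hasFDerivAt_properDensity (frame o) (Real.sqrt (-φ.g.eval φ.w φ.w) / c) (φ.μ o)
    φ.entropy
  have := hℓ.fderiv_apply h (fun r => { φ with entropy := r }) φ.entropy rfl (fun _ => rfl)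
    (Eventually.of_forall fun _ => hφ) (hasFDerivAt_const φ.A _) (hasFDerivAt_const φ.F _)
    (hasFDerivAt_const (φ.ρ o c) _) hr (hasFDerivAt_const (φ.u c) _)
    (hasFDerivAt_const φ.cauchy _) φ.entropy
  refine this.trans ?_
  congr 1
  simp [EMState.s, ratio, -mul_eq_mul_right_iff]
  ring

/-- The convective term `w ⊗ ∂ℓ/∂w`; the coupling to `A` contributes only through `ρ u`, which does not
involve the normalization of `w`. -/
theorem HasFormF.smul_dw_apply (hc : 0 < c) (hℓ : HasFormF o c q ℓ 𝔢) (h : 𝔢.DiffAt o c φ)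
    (hφ : φ.Timelike) (α : CoV V) (v : V) :
    α φ.w • ℓ.dw φ v
      = (1 / c ^ 2 * (α (φ.u c) * φ.g.eval (φ.u c) v)
            * (φ.ρ o c * 𝔢.dρ o c φ + φ.s o c * 𝔢.ds o c φ - 𝔢.du o c φ (φ.u c))
          - α (φ.u c) * 𝔢.du o c φ v - q * φ.ρ o c * (φ.A v * α (φ.u c))) • φ.μ o := by
  have := hℓ.fderiv_apply h (fun w => { φ with w := w }) φ.w rfl (fun _ => rfl)
    hφ.eventually (hasFDerivAt_const φ.A _) (hasFDerivAt_const φ.F _)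
    (hφ.hasFDerivAt_proper (ratio (frame o) φ.mass (φ.μ o)))
    (hφ.hasFDerivAt_proper (ratio (frame o) φ.entropy (φ.μ o))) hφ.hasFDerivAt_u
    (hasFDerivAt_const φ.cauchy _) v
  have h2 : ℓ.dw φ v = _ := this
  rw [h2, smul_smul]
  congr 1
  have h0 := hφ.sqrt_pos
  simp only [EMState.ρ, EMState.s, EMState.u]
  set N := Real.sqrt (-φ.g.eval φ.w φ.w)
  generalize 𝔢.dρ o c φ = a1
  generalize 𝔢.ds o c φ = a2
  generalize 𝔢.du o c φ = a3
  generalize ratio (frame o) φ.mass (φ.μ o) = r1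
  generalize ratio (frame o) φ.entropy (φ.μ o) = r2
  simp [SymForm.eval_smul_left]
  field_simp
  ring

/-- The stress-energy-momentum tensor in terms of `𝔢`. -/
theorem HasFormF.stressTensor_eq (hc : 0 < c) (hℓ : HasFormF o c q ℓ 𝔢) (h : 𝔢.DiffAt o c φ)
    (hφ : φ.Timelike) :
    elasticI ℓ φ = (elasticIII o c 𝔢 φ).density (φ.μ o) ∧
      stressTensor ℓ φ = (fluidStressIII o c 𝔢 φ - elasticIII o c 𝔢 φ).density (φ.μ o) := by
  have hel : elasticI ℓ φ = (elasticIII o c 𝔢 φ).density (φ.μ o) := by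
    funext α v
    rw [elasticI_apply, hℓ.dcauchy_apply h hφ, smul_smul]
    change _ = ((-2 : ℝ) * 𝔢.dcauchy o c φ (symProd α (φ.cauchy.flat v))) • φ.μ o
    congr 1
    ring
  refine ⟨hel, ?_⟩
  rw [stressTensor_eq_sub_elasticI, hel]
  funext α v
  change fluidStressI ℓ φ α v - (elasticIII o c 𝔢 φ α v) • φ.μ o
    = (fluidStressIII o c 𝔢 φ α v - elasticIII o c 𝔢 φ α v) • φ.μ o
  rw [sub_smul (fluidStressIII o c 𝔢 φ α v)]
  congr 1
  rw [fluidStressI, hℓ φ hφ, hℓ.dmass_self h hφ, hℓ.dentropy_self h hφ, hℓ.smul_dw_apply hc h hφ,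
    hℓ.dA_apply h hφ, hℓ.dF_apply h hφ]
  simp only [fluidStressIII, EMState.P, EnergyF.val, smul_apply, smul_eq_mul]
  module

end Stress

/-! ### The electric and magnetic fields as functions of `u` and `F` -/

section Fields

variable {V : Type*} [NormedAddCommGroup V] [NormedSpace ℝ V]

/-- The bilinear map `(F, u) ↦ i_u F` into the covectors. -/
def interiorCoV (V : Type*) [NormedAddCommGroup V] [NormedSpace ℝ V] :
    Form V 2 →L[ℝ] V →L[ℝ] CoV V :=
  (ContinuousLinearMap.compL ℝ V (Form V 1) (CoV V)
      (ContinuousAlternatingMap.ofSubsingletonLIE (𝕜 := ℝ) (E := V) (F := ℝ)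
        (0 : Fin 1)).symm.toContinuousLinearEquiv.toContinuousLinearMap).comp
    (ContinuousAlternatingMap.curryLeftLI (𝕜 := ℝ) (E := V) (F := ℝ)
      (n := 1)).toContinuousLinearMap

theorem interiorCoV_apply (F : Form V 2) (u : V) : interiorCoV V F u = toCoV (interior u F) := rfl

variable [FiniteDimensional ℝ V] {d : ℕ}

/-- The Hodge star as a continuous linear map. -/
def hodgeCLM (e : Module.Basis (Fin d) ℝ V) (g : SymForm V) {k l : ℕ} (h : d = l + k) :
    Form V k →L[ℝ] Form V l :=
  (1 / (k.factorial : ℝ)) • ∑ a : Fin k → Fin d,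
    (ContinuousAlternatingMap.apply ℝ V ℝ fun i => sharp e g (coframe e (a i))).smulRight
      (contract k (fun i => e (a i)) (reindex h (vol e g)))

theorem hodgeCLM_apply (e : Module.Basis (Fin d) ℝ V) (g : SymForm V) {k l : ℕ} (h : d = l + k)
    (θ : Form V k) : hodgeCLM e g h θ = hodge e g h θ := by
  simp [hodgeCLM, hodge, sum_apply]

/-- The bilinear map `(F, u) ↦ i_u ⋆F`. -/
def interiorHodge (e : Module.Basis (Fin d) ℝ V) (g : SymForm V) {k l : ℕ} (h : d = l + 1 + k) :
    Form V k →L[ℝ] V →L[ℝ] Form V l :=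
  (ContinuousAlternatingMap.curryLeftLI (𝕜 := ℝ) (E := V) (F := ℝ)
    (n := l)).toContinuousLinearMap.comp (hodgeCLM e g h)

theorem interiorHodge_apply (e : Module.Basis (Fin d) ℝ V) (g : SymForm V) {k l : ℕ}
    (h : d = l + 1 + k) (θ : Form V k) (u : V) :
    interiorHodge e g h θ u = interior u (hodge (l := l + 1) e g h θ) := by
  rw [← hodgeCLM_apply]
  rfl

end Fields

/-! ### Energy functions of the electric and magnetic fields -/

section Energy

variable {V : Type*} [NormedAddCommGroup V] [NormedSpace ℝ V] [FiniteDimensional ℝ V]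
  {k : ℕ} [Fact (Module.finrank ℝ V = k + 3)]

/-- The energy function `𝔢(ρ, s, u, F, 𝖼, g) = ε(ρ, s, -c⁻¹ i_u F, -c⁻¹ i_u ⋆F, 𝖼, g)`. -/
def EnergyEB.toF (o : Orient (k + 3) V) (c : ℝ) (ε : EnergyEB k V) : EnergyF V :=
  fun ρ s u F b g => ε ρ s ((-(1 / c)) • toCoV (interior u F))
    ((-(1 / c)) • interior u (hodge (l := k + 1) (frame o) g (by omega) F)) b g

variable {o : Orient (k + 3) V} {c q : ℝ} {ε : EnergyEB k V} {φ : EMState (k + 3) V}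

theorem HasFormEB.hasFormF {ℓ : Lagrangian (k + 3) V} (h : HasFormEB o c q ℓ ε) :
    HasFormF o c q ℓ (ε.toF o c) := fun φ hφ => h φ hφ

theorem EnergyEB.DiffAt.hasFDerivAt_toF (h : ε.DiffAt o c φ) :
    ∃ D : ℝ × ℝ × V × Form V 2 × SymForm V →L[ℝ] ℝ,
      HasFDerivAt (fun p : ℝ × ℝ × V × Form V 2 × SymForm V =>
        ε.toF o c p.1 p.2.1 p.2.2.1 p.2.2.2.1 p.2.2.2.2 φ.g) D
        (φ.ρ o c, φ.s o c, φ.u c, φ.F, φ.cauchy) ∧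
      ∀ r s v F b, D (r, s, v, F, b) = r * ε.dρ o c φ + s * ε.ds o c φ
        + ε.dE o c φ ((-(1 / c)) • (toCoV (interior v φ.F) + toCoV (interior (φ.u c) F)))
        + ε.dB o c φ ((-(1 / c)) •
            (interior v (hodge (l := k + 1) (frame o) φ.g (by omega) φ.F)
              + interior (φ.u c) (hodge (l := k + 1) (frame o) φ.g (by omega) F)))
        + ε.dcauchy o c φ b := by
  obtain ⟨D, hD, hD'⟩ := h.hasFDerivAt
  have hdim : k + 3 = k + 1 + 2 := by omega
  let x₀ : ℝ × ℝ × V × Form V 2 × SymForm V := (φ.ρ o c, φ.s o c, φ.u c, φ.F, φ.cauchy)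
  have hid := hasFDerivAt_id (𝕜 := ℝ) x₀
  have hr := hid.fst
  have hs := hid.snd.fst
  have hu := hid.snd.snd.fst
  have hF := hid.snd.snd.snd.fst
  have hb := hid.snd.snd.snd.snd
  have hE := (((interiorCoV V).hasFDerivAt.comp x₀ hF).clm_apply hu).const_smul (-(1 / c))
  have hB := (((interiorHodge (frame o) φ.g hdim).hasFDerivAt.comp x₀ hF).clm_apply hu).const_smul
    (-(1 / c))
  have hΦ := hr.prodMk (hs.prodMk (hE.prodMk (hB.prodMk hb)))
  have hBx : (-(1 / c)) • interiorHodge (frame o) φ.g hdim φ.F (φ.u c) = φ.B o c := by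
    rw [interiorHodge_apply]
    rfl
  have hD2 : HasFDerivAt (fun p : ℝ × ℝ × CoV V × Form V k × SymForm V =>
        ε p.1 p.2.1 p.2.2.1 p.2.2.2.1 p.2.2.2.2 φ.g) D
        (φ.ρ o c, φ.s o c, (-(1 / c)) • interiorCoV V φ.F (φ.u c),
          (-(1 / c)) • interiorHodge (frame o) φ.g hdim φ.F (φ.u c), φ.cauchy) := by
    rw [hBx]
    exact hD
  have hc := HasFDerivAt.comp x₀ (g := fun p : ℝ × ℝ × CoV V × Form V k × SymForm V =>
        ε p.1 p.2.1 p.2.2.1 p.2.2.2.1 p.2.2.2.2 φ.g) hD2 hΦ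
  refine ⟨_, hc.congr_of_eventuallyEq (Filter.Eventually.of_forall fun p => ?_), ?_⟩
  · simp only [EnergyEB.toF, Function.comp, ← interiorHodge_apply, ← interiorCoV_apply]
    rfl
  · intro r s v F b
    rw [← interiorHodge_apply, ← interiorHodge_apply, ← interiorCoV_apply, ← interiorCoV_apply,
      ← hD']
    rfl

theorem EnergyEB.DiffAt.toF (h : ε.DiffAt o c φ) : (ε.toF o c).DiffAt o c φ := by
  obtain ⟨D, hD, -⟩ := h.hasFDerivAt_toF
  exact hD.differentiableAt

/-- The partial derivatives of `𝔢` in terms of those of `ε`. -/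
theorem EnergyEB.DiffAt.partials_toF (h : ε.DiffAt o c φ) (r s : ℝ) (v : V) (F : Form V 2)
    (b : SymForm V) :
    r * (ε.toF o c).dρ o c φ + s * (ε.toF o c).ds o c φ + (ε.toF o c).du o c φ v
        + (ε.toF o c).dF o c φ F + (ε.toF o c).dcauchy o c φ b
      = r * ε.dρ o c φ + s * ε.ds o c φ
        + ε.dE o c φ ((-(1 / c)) • (toCoV (interior v φ.F) + toCoV (interior (φ.u c) F)))
        + ε.dB o c φ ((-(1 / c)) •
            (interior v (hodge (l := k + 1) (frame o) φ.g (by omega) φ.F)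
              + interior (φ.u c) (hodge (l := k + 1) (frame o) φ.g (by omega) F)))
        + ε.dcauchy o c φ b := by
  obtain ⟨D, hD, hD'⟩ := h.hasFDerivAt_toF
  obtain ⟨D₂, hD₂, hD₂'⟩ := h.toF.hasFDerivAt
  rw [← hD', ← hD₂', hD.unique hD₂]

/-- Covariance under the reflection in the hyperplane orthogonal to `u`, which fixes `E`, `B`, `𝖼` and
`g`: the derivative of `ε` in `B` annihilates the forms `u^♭ ∧ i_u θ`, so that `(∂ε/∂B)^♭` is a form on
the rest space of the continuum. -/
theorem dB_hatForm_eq_zero (hc : 0 < c) (hφ : φ.Timelike) (hcauchy : φ.cauchy.flat φ.w = 0)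
    (hε : ∀ (T : V ≃L[ℝ] V) (ρ s : ℝ) (E : CoV V) (B : Form V k) (b g : SymForm V),
      IsLorentz (k + 3) g → ε ρ s (E.comp (T : V →L[ℝ] V))
        (B.compContinuousLinearMap (T : V →L[ℝ] V)) (b.pullback T) (g.pullback T) = ε ρ s E B b g)
    (θ : Form V k) : ε.dB o c φ (hatForm (φ.g.flat (φ.u c)) (φ.u c) θ) = 0 := by
  set u := φ.u c with hu
  have huu : φ.g.eval u u = -c ^ 2 := hφ.eval_u
  have hc0 : c ≠ 0 := hc.ne'
  -- the reflection `x ↦ x - 2 g(u,x)/g(u,u) u`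
  let R : V →L[ℝ] V := ContinuousLinearMap.id ℝ V + (φ.g.flat u).smulRight ((2 / c ^ 2) • u)
  have hR : ∀ x, R x = x + φ.g.eval u x • (2 / c ^ 2) • u := fun x => rfl
  have hRR : ∀ x, R (R x) = x := by
    intro x
    rw [hR (R x), hR x, SymForm.eval_add_right, SymForm.eval_smul_right, SymForm.eval_smul_right,
      huu, add_assoc, smul_smul, smul_smul, ← add_smul]
    have : φ.g.eval u x * (2 / c ^ 2)
        + (φ.g.eval u x + φ.g.eval u x * (2 / c ^ 2 * -c ^ 2)) * (2 / c ^ 2) = 0 := by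
      field_simp
      ring
    rw [this, zero_smul, add_zero]
  let T : V ≃L[ℝ] V := ContinuousLinearEquiv.equivOfInverse R R hRR hRR
  have hT : (T : V →L[ℝ] V) = R := rfl
  have hg : φ.g.pullback T = φ.g := by
    ext x y
    change φ.g.eval (R x) (R y) = φ.g.eval x y
    simp only [hR, SymForm.eval_add_right, SymForm.eval_add_left, SymForm.eval_smul_right,
      SymForm.eval_smul_left, huu, φ.g.eval_comm x u]
    field_simp
    ring
  have hb : φ.cauchy.pullback T = φ.cauchy := by
    have h1 : ∀ x, φ.cauchy.eval u x = 0 := by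
      intro x
      have := congrArg (fun T : CoV V => T x) hcauchy
      simp only [SymForm.flat_apply] at this
      rw [hu, EMState.u, SymForm.eval_smul_left, this]
      simp
    ext x y
    change φ.cauchy.eval (R x) (R y) = φ.cauchy.eval x y
    simp only [hR, SymForm.eval_add_right, SymForm.eval_add_left, SymForm.eval_smul_right,
      SymForm.eval_smul_left, φ.cauchy.eval_comm x u, h1]
    ring
  have hE : (φ.E c).comp (T : V →L[ℝ] V) = φ.E c := by
    have h1 : φ.E c u = 0 := by
      change -(1 / c) * toCoV (interior u φ.F) u = 0
      have h2 : φ.F ![u, u] = 0 := φ.F.map_eq_zero_of_eq ![u, u] (i := 0) (j := 1) rfl (by simp)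
      rw [toCoV_apply, interior_apply, h2, mul_zero]
    ext x
    change φ.E c (R x) = _
    rw [hR, map_add, map_smul, map_smul, h1]
    simp
  have hcomp : ∀ B : Form V k, B.compContinuousLinearMap (T : V →L[ℝ] V)
      = B + (2 / c ^ 2) • hatForm (φ.g.flat u) u B := by
    intro B
    rw [hT, ← hatForm_smul_vector]
    exact Form.comp_rankOne B _ _
  have hB : hatForm (φ.g.flat u) u (φ.B o c) = 0 := by
    rw [EMState.B, hatForm_smul, hatForm_interior_self, smul_zero]
  have hinv : ∀ B : Form V k, ε (φ.ρ o c) (φ.s o c) (φ.E c)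
      (B + (2 / c ^ 2) • hatForm (φ.g.flat u) u B) φ.cauchy φ.g
        = ε (φ.ρ o c) (φ.s o c) (φ.E c) B φ.cauchy φ.g := by
    intro B
    have := hε T (φ.ρ o c) (φ.s o c) (φ.E c) B φ.cauchy φ.g hφ.1
    rwa [hE, hb, hg, hcomp] at this
  by_cases hd : DifferentiableAt ℝ
      (fun B => ε (φ.ρ o c) (φ.s o c) (φ.E c) B φ.cauchy φ.g) (φ.B o c)
  · have h1 := hd.hasFDerivAt.hasLineDerivAt θ
    have h2 := hd.hasFDerivAt.hasLineDerivAt (θ + (2 / c ^ 2) • hatForm (φ.g.flat u) u θ)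
    -- the pull-back by the reflection maps the line through `B` in direction `θ` to the line through `B`
    -- in the direction of the pull-back of `θ`, and `ε` takes the same values on both
    have h3 : ∀ t : ℝ, φ.B o c + t • (θ + (2 / c ^ 2) • hatForm (φ.g.flat u) u θ)
        = (φ.B o c + t • θ) + (2 / c ^ 2) • hatForm (φ.g.flat u) u (φ.B o c + t • θ) := by
      intro t
      rw [hatForm_add, hB, hatForm_smul, smul_add, zero_add, smul_comm t, add_assoc]
    unfold HasLineDerivAt at h1 h2
    simp only [h3, hinv] at h2
    have h4 := h1.unique h2
    rw [map_add, map_smul, smul_eq_mul] at h4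
    have h5 : 2 / c ^ 2 ≠ 0 := by positivity
    have h6 : 2 / c ^ 2 * ε.dB o c φ (hatForm (φ.g.flat u) u θ) = 0 := by
      unfold EnergyEB.dB
      linarith
    exact (mul_eq_zero.1 h6).resolve_left h5
  -- here `dB` is the zero functional by the convention for `fderiv`
  · rw [EnergyEB.dB, fderiv_zero_of_not_differentiableAt hd]
    rfl

theorem EnergyEB.DiffAt.elasticIII_toF (h : ε.DiffAt o c φ) :
    elasticIII o c (ε.toF o c) φ = elasticII o c ε φ := by
  funext α v
  have h1 := h.partials_toF 0 0 0 0 (symProd α (φ.cauchy.flat v))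
  have h2 : ∀ (l : ℕ) (θ : Form V (l + 1)), interior (0 : V) θ = 0 := fun _ θ => map_zero _
  have h3 : hodge (l := k + 1) (frame o) φ.g (by omega) (0 : Form V 2) = 0 := by
    rw [← hodgeCLM_apply, map_zero]
  have h4 : toCoV (0 : Form V 1) = 0 := rfl
  have h5 : ∀ (v : V) (l : ℕ), interior v (0 : Form V (l + 1)) = 0 := fun _ _ => rfl
  simp only [h2, h3, h4, h5, map_zero, zero_mul, add_zero, zero_add, smul_zero] at h1
  change (-2 : ℝ) * (ε.toF o c).dcauchy o c φ (symProd α (φ.cauchy.flat v))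
    = (-2 : ℝ) * ε.dcauchy o c φ (symProd α (φ.cauchy.flat v))
  rw [h1]

/-- The stress in terms of `𝔢` is the stress in terms of `ε`. -/
theorem EnergyEB.DiffAt.fluidStressIII_toF (h : ε.DiffAt o c φ) (hc : 0 < c) (hφ : φ.Timelike)
    (hY : ∀ θ, ε.dB o c φ (hatForm (φ.g.flat (φ.u c)) (φ.u c) θ) = 0) :
    fluidStressIII o c (ε.toF o c) φ = fluidStressII o c ε φ := by
  have hdim : k + 3 = k + 1 + 2 := by omega
  have h2 : ∀ (l : ℕ) (θ : Form V (l + 1)), interior (0 : V) θ = 0 := fun _ θ => map_zero _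
  have h3 : hodge (l := k + 1) (frame o) φ.g hdim (0 : Form V 2) = 0 := by
    rw [← hodgeCLM_apply, map_zero]
  have h4 : toCoV (0 : Form V 1) = 0 := rfl
  have h5 : ∀ (v : V) (l : ℕ), interior v (0 : Form V (l + 1)) = 0 := fun _ _ => rfl
  have hρ : (ε.toF o c).dρ o c φ = ε.dρ o c φ := by
    have h1 := h.partials_toF 1 0 0 0 0
    simpa only [h2, h3, h4, h5, map_zero, zero_mul, one_mul, add_zero, zero_add, smul_zero] using h1
  have hs : (ε.toF o c).ds o c φ = ε.ds o c φ := by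
    have h1 := h.partials_toF 0 1 0 0 0
    simpa only [h2, h3, h4, h5, map_zero, zero_mul, one_mul, add_zero, zero_add, smul_zero] using h1
  have hu : ∀ v, (ε.toF o c).du o c φ v = -(1 / c) * ε.dE o c φ (toCoV (interior v φ.F))
      + -(1 / c) * ε.dB o c φ (interior v (hodge (l := k + 1) (frame o) φ.g hdim φ.F)) := by
    intro v
    have h1 := h.partials_toF 0 0 v 0 0
    simpa only [h2, h3, h4, h5, map_zero, zero_mul, one_mul, add_zero, zero_add, smul_zero, map_smul,
      smul_eq_mul] using h1
  have hF : ∀ F, (ε.toF o c).dF o c φ F = -(1 / c) * ε.dE o c φ (toCoV (interior (φ.u c) F))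
      + -(1 / c) * ε.dB o c φ
        (interior (φ.u c) (hodge (l := k + 1) (frame o) φ.g hdim F)) := by
    intro F
    have h1 := h.partials_toF 0 0 0 F 0
    simpa only [h2, h3, h4, h5, map_zero, zero_mul, one_mul, add_zero, zero_add, smul_zero, map_smul,
      smul_eq_mul] using h1
  funext α v
  -- everything but the terms with `∂ε/∂B` matches after expanding `i_u (α ∧ i_v F)`
  have key := hφ.1.magnetic_identity (frame o) hdim (by omega) hc.ne' (hφ.eval_u (c := c))
    (ε.dB o c φ) hY φ.F (φ.E c) (poynting o c ε φ) (φ.B o c) rfl rfl rfl α v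
  have hEv : ∀ x, φ.E c x = -(1 / c) * φ.F ![φ.u c, x] := by
    intro x
    change -(1 / c) * toCoV (interior (φ.u c) φ.F) x = _
    rw [toCoV_apply]
    rfl
  have hEE : ε.dE o c φ (φ.E c) = -(1 / c) * ε.dE o c φ (toCoV (interior (φ.u c) φ.F)) := by
    rw [EMState.E, map_smul, smul_eq_mul]
  have hBB : ε.dB o c φ (φ.B o c) = -(1 / c) * ε.dB o c φ
      (interior (φ.u c) (hodge (l := k + 1) (frame o) φ.g hdim φ.F)) := by
    rw [EMState.B, map_smul, smul_eq_mul]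
  have hW : toCoV (interior (φ.u c) (wedge α (interior v φ.F)))
      = α (φ.u c) • toCoV (interior v φ.F) + φ.F ![φ.u c, v] • α := by
    ext x
    have h6 : φ.F ![v, φ.u c] = -φ.F ![φ.u c, v] := vecCons_swap φ.F _ _ _
    have h7 : wedge α (interior v φ.F) ![φ.u c, x]
        = α (φ.u c) * interior v φ.F ![x] - wedge α (interior (φ.u c) (interior v φ.F)) ![x] :=
      wedge_vecCons _ _ _ _
    have h8 : wedge α (interior (φ.u c) (interior v φ.F)) ![x]
        = α x * interior (φ.u c) (interior v φ.F) ![] := wedge_vecCons_zero _ _ _ _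
    have h9 : interior (φ.u c) (interior v φ.F) ![] = φ.F ![v, φ.u c] := rfl
    rw [toCoV_apply, interior_apply]
    change wedge α (interior v φ.F) ![φ.u c, x] = α (φ.u c) * toCoV (interior v φ.F) x
      + φ.F ![φ.u c, v] * α x
    rw [h7, h8, h9, h6, toCoV_apply]
    ring
  have hval : (ε.toF o c).val o c φ = ε.val o c φ := rfl
  simp only [fluidStressIII, fluidStressII, hρ, hs, hu, hF, hW, hval, hEv, map_add, map_smul,
    smul_eq_mul, hEE, EMState.P]
  rw [hBB] at key ⊢
  linear_combination key

/-- The stress-energy-momentum tensor in terms of a covariant `ε`. -/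
theorem HasFormEB.stressTensor_eq {ℓ : Lagrangian (k + 3) V} (hℓ : HasFormEB o c q ℓ ε)
    (h : ε.DiffAt o c φ) (hc : 0 < c) (hφ : φ.Timelike) (hcauchy : φ.cauchy.flat φ.w = 0)
    (hε : ∀ (T : V ≃L[ℝ] V) (ρ s : ℝ) (E : CoV V) (B : Form V k) (b g : SymForm V),
      IsLorentz (k + 3) g → ε ρ s (E.comp (T : V →L[ℝ] V))
        (B.compContinuousLinearMap (T : V →L[ℝ] V)) (b.pullback T) (g.pullback T)
          = ε ρ s E B b g) :
    elasticI ℓ φ = (elasticII o c ε φ).density (φ.μ o) ∧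
      stressTensor ℓ φ = (fluidStressII o c ε φ - elasticII o c ε φ).density (φ.μ o) := by
  rw [← h.elasticIII_toF, ← h.fluidStressIII_toF hc hφ (dB_hatForm_eq_zero hc hφ hcauchy hε)]
  exact hℓ.hasFormF.stressTensor_eq hc h.toF hφ

end Energy

end EMContinua

end

theorem mainTheorem11 (k : ℕ) {M : Type*} [TopologicalSpace M]
    [ChartedSpace (EuclideanSpace ℝ (Fin (k + 3))) M] [IsManifold (𝓡 (k + 3)) ∞ M]
    (o : ∀ x : M, EMContinua.Orient (k + 3) (TangentSpace (𝓡 (k + 3)) x))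
    (c q : ℝ) (hc : 0 < c)
    (ℓ : ∀ x : M, EMContinua.Lagrangian (k + 3) (TangentSpace (𝓡 (k + 3)) x))
    (N : Set M)
    (φ : ∀ x : M, EMContinua.EMState (k + 3) (TangentSpace (𝓡 (k + 3)) x))
    (htimelike : ∀ x ∈ N, (φ x).Timelike)
    (hcauchy : ∀ x ∈ N, (φ x).cauchy.flat (φ x).w = 0) :
    (∀ x ∈ N, (ℓ x).DiffAt (φ x) →
      EMContinua.stressTensor (ℓ x) (φ x)
        = EMContinua.fluidStressI (ℓ x) (φ x) - EMContinua.elasticI (ℓ x) (φ x)) ∧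
    (∀ ε : ∀ x : M, EMContinua.EnergyEB k (TangentSpace (𝓡 (k + 3)) x),
      EMContinua.SpacetimeCovariant ε →
      (∀ x, EMContinua.HasFormEB (o x) c q (ℓ x) (ε x)) →
      ∀ x ∈ N, (ε x).DiffAt (o x) c (φ x) →
        EMContinua.elasticI (ℓ x) (φ x)
          = (EMContinua.elasticII (o x) c (ε x) (φ x)).density ((φ x).μ (o x)) ∧
        EMContinua.stressTensor (ℓ x) (φ x)
          = (EMContinua.fluidStressII (o x) c (ε x) (φ x)
              - EMContinua.elasticII (o x) c (ε x) (φ x)).density ((φ x).μ (o x))) ∧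
    (∀ 𝔢 : ∀ x : M, EMContinua.EnergyF (TangentSpace (𝓡 (k + 3)) x),
      (∀ x, EMContinua.HasFormF (o x) c q (ℓ x) (𝔢 x)) →
      ∀ x ∈ N, (𝔢 x).DiffAt (o x) c (φ x) →
        EMContinua.elasticI (ℓ x) (φ x)
          = (EMContinua.elasticIII (o x) c (𝔢 x) (φ x)).density ((φ x).μ (o x)) ∧
        EMContinua.stressTensor (ℓ x) (φ x)
          = (EMContinua.fluidStressIII (o x) c (𝔢 x) (φ x)
              - EMContinua.elasticIII (o x) c (𝔢 x) (φ x)).density ((φ x).μ (o x))) := by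
  refine ⟨fun x _ _ => EMContinua.stressTensor_eq_sub_elasticI _ _, ?_, ?_⟩
  · intro ε hε hℓ x hx hd
    exact (hℓ x).stressTensor_eq hd hc (htimelike x hx) (hcauchy x hx) (hε x x)
  · intro 𝔢 hℓ x hx hd
    exact (hℓ x).stressTensor_eq hc hd (htimelike x hx)
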